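/- Let $p$ be a prime, let $K$ be a finite extension of $\mathbb Q_p$ containing an element $\pi$ with $\pi^{p-1}+p=0$, and let $|\cdot|$ be the norm extending the $p$-adic norm of $\mathbb Q_p$. Let $A=(w_{ij})$ be an $n\times N$ integer matrix of rank $n$ with columns $\mathbf w_1,\dots,\mathbf w_N\in\mathbb Z^n$, and let $\gamma_1,\dots,\gamma_n\in K$. Let $\Delta\subset\mathbb R^n$ be the convex hull of $\{0,\mathbf w_1,\dots,\mathbf w_N\}$, let $\delta$ be the convex cone generated by $\mathbf w_1,\dots,\mathbf w_N$, and for $\mathbf w\in\delta$ put $d(\mathbf w)=\inf\{c>0:\mathbf w\in c\Delta\}$. Write $\mathbf x=(x_1,\dots,x_N)$ and $\mathbf t=(t_1,\dots,t_n)$. Let $K\langle\mathbf x\rangle^\dagger$ be the ring of power series $\sum_{\mathbf v\in\mathbb Z_{\ge0}^N}a_{\mathbf v}\mathbf x^{\mathbf v}$ with $a_{\mathbf v}\in K$ such that $|a_{\mathbf v}|r^{|\mathbf v|}$ is bounded for some $r>1$. Let $L^\dagger$ be the $K\langle\mathbf x\rangle^\dagger$-module of series $\sum_{\mathbf v\in\mathbb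 Z_{\ge0}^N,\ \mathbf w\in\mathbb Z^n\cap\delta}a_{\mathbf v\mathbf w}\mathbf x^{\mathbf v}\mathbf t^{\mathbf w}$ with $a_{\mathbf v\mathbf w}\in K$ such that $|a_{\mathbf v\mathbf w}|r^{|\mathbf v|}s^{d(\mathbf w)}$ is bounded for some $r>1$, $s>1$. Let $C^\cdot(L^\dagger)$ be the complex of $K\langle\mathbf x\rangle^\dagger$-modules with $$C^k(L^\dagger)=\Big\{\sum_{1\le i_1<\dots<i_k\le n}f_{i_1\dots i_k}\frac{\mathrm dt_{i_1}}{t_{i_1}}\wedge\dots\wedge\frac{\mathrm dt_{i_k}}{t_{i_k}}:\ f_{i_1\dots i_k}\in L^\dagger\Big\},\qquad d(\omega)=\mathrm d_{\mathbf t}\omega+\sum_{i=1}^n\Big(\gamma_i+\pi\sum_{j=1}^Nw_{ij}x_j\mathbf t^{\mathbf w_j}\Big)\frac{\mathrm dt_i}{t_i}\wedge\omega ,$$ where $\mathrm d_{\mathbf t}$ is the exterior derivative in the variables $\mathbf t$. Let $K'$ be a finite extension of $K$, let $\mathbf a=(a_1,\dots,a_N)\in K'^N$ with $|a_j|\le1$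 for all $j$, and regard $K'$ as a $K\langle\mathbf x\rangle^\dagger$-algebra via $f\mapsto f(\mathbf a)$. Let $L_0^\dagger$ be the space of series $\sum_{\mathbf w\in\mathbb Z^n\cap\delta}a_{\mathbf w}\mathbf t^{\mathbf w}$ with $a_{\mathbf w}\in K'$ such that $|a_{\mathbf w}|s^{d(\mathbf w)}$ is bounded for some $s>1$, and let $C^\cdot(L_0^\dagger)$ be the complex of logarithmic forms $\sum f_{i_1\dots i_k}\frac{\mathrm dt_{i_1}}{t_{i_1}}\wedge\dots\wedge\frac{\mathrm dt_{i_k}}{t_{i_k}}$ with $f_{i_1\dots i_k}\in L_0^\dagger$ and with differential $$d(\omega)=\mathrm d_{\mathbf t}\omega+\sum_{i=1}^n\Big(\gamma_i+\pi\sum_{j=1}^Nw_{ij}a_j\mathbf t^{\mathbf w_j}\Big)\frac{\mathrm dt_i}{t_i}\wedge\omega .$$ Then in the derived category of complexes of $K\langle\mathbf x\rangle^\dagger$-modules there is an isomorphism $$C^\cdot(L^\dagger)\otimes^L_{K\langle\mathbf x\rangle^\dagger}K'\cong C^\cdot(L_0^\dagger).$$ -/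

import Mathlib

open CategoryTheory Opposite
open scoped Pointwise

universe u w

namespace PGKZ

/-! ### The derived tensor product with a module, for bounded above complexes -/

section DerivedTensor

/-- A bounded above complex in an abelian category with enough projectives has a resolution by a
bounded above complex of projective objects. -/
theorem exists_projective_resolution {C : Type*} [Category* C] [Abelian C] [EnoughProjectives C]
    (X : CochainComplex C ℤ) (b : ℤ) [X.IsStrictlyLE b] :
    ∃ (P : CochainComplex C ℤ) (f : P ⟶ X), P.IsStrictlyLE b ∧
      (∀ k, Projective (P.X k)) ∧ QuasiIso f := by
  have hY : ((CochainComplex.opEquivalence C).functor.obj (op X)).IsStrictlyGE (-b) := by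
    rw [CochainComplex.isStrictlyGE_iff]
    intro i hi
    exact (X.isZero_of_isStrictlyLE b (-i) (by lia)).op
  obtain ⟨L, i, hi, hL, hLb⟩ :=
    CochainComplex.Plus.modelCategoryQuillen.exists_quasiIso_injective
      ((CochainComplex.opEquivalence C).functor.obj (op X)) (-b)
  let E := CochainComplex.opEquivalence C
  let g : (E.inverse.obj L).unop ⟶ (E.inverse.obj (E.functor.obj (op X))).unop :=
    (E.inverse.map i).unop
  have hg : QuasiIso g := by
    rw [quasiIso_iff]
    intro n
    rw [quasiIsoAt_iff' g (n - 1) n (n + 1) (by simp) (by simp)]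
    have h := quasiIso_iff i |>.1 hi (-n)
    rw [quasiIsoAt_iff' i (-(n + 1)) (-n) (-(n - 1)) (by simp; ring) (by simp; ring)] at h
    exact ShortComplex.quasiIso_unopMap
      ((HomologicalComplex.shortComplexFunctor' Cᵒᵖ (ComplexShape.up ℤ)
        (-(n + 1)) (-n) (-(n - 1))).map i)
  refine ⟨(E.inverse.obj L).unop, g ≫ (E.unitIso.app (op X)).hom.unop, ?_, ?_, inferInstance⟩
  · rw [CochainComplex.isStrictlyLE_iff]
    intro k hk
    exact (L.isZero_of_isStrictlyGE (-b) (-k) (by lia)).unop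
  · intro k
    have := hL (-k)
    exact inferInstanceAs (Projective (L.X (-k)).unop)

/-- A chosen bounded above complex of projectives resolving `X`. -/
noncomputable def projRes {C : Type*} [Category* C] [Abelian C] [EnoughProjectives C]
    (X : CochainComplex C ℤ) (b : ℤ) [X.IsStrictlyLE b] : CochainComplex C ℤ :=
  (exists_projective_resolution X b).choose

/-- The quasi-isomorphism from the chosen projective resolution of `X` to `X`. -/
noncomputable def projResπ {C : Type*} [Category* C] [Abelian C] [EnoughProjectives C]
    (X : CochainComplex C ℤ) (b : ℤ) [X.IsStrictlyLE b] : projRes X b ⟶ X :=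
  (exists_projective_resolution X b).choose_spec.choose

theorem projRes_spec {C : Type*} [Category* C] [Abelian C] [EnoughProjectives C]
    (X : CochainComplex C ℤ) (b : ℤ) [X.IsStrictlyLE b] :
    (projRes X b).IsStrictlyLE b ∧ (∀ k, Projective ((projRes X b).X k)) ∧
      QuasiIso (projResπ X b) :=
  (exists_projective_resolution X b).choose_spec.choose_spec

/-- The termwise tensor product of a complex of `B`-modules with a `B`-module `M`. -/
noncomputable def tensorComplex {B : Type u} [CommRing B]
    (X : CochainComplex (ModuleCat.{u} B) ℤ) (M : ModuleCat.{u} B) :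
    CochainComplex (ModuleCat.{u} B) ℤ :=
  ((MonoidalCategory.tensorRight M).mapHomologicalComplex (ComplexShape.up ℤ)).obj X

/-- The derived tensor product `X ⊗ᴸ M` of a complex of `B`-modules `X` vanishing in degrees `> b`
with a `B`-module `M`, as an object of the derived category of `B`-modules: replace `X` by a
bounded above complex of projectives and tensor termwise with `M`. -/
noncomputable def derivedTensor {B : Type u} [CommRing B] [HasDerivedCategory.{w} (ModuleCat.{u} B)]
    (X : CochainComplex (ModuleCat.{u} B) ℤ) (b : ℤ) [X.IsStrictlyLE b] (M : ModuleCat.{u} B) :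
    DerivedCategory (ModuleCat.{u} B) :=
  DerivedCategory.Q.obj (tensorComplex (projRes X b) M)

end DerivedTensor

/-! ### Logarithmic forms with a differential given by commuting operators -/

section Forms

variable {B : Type*} [CommRing B] {M : Type*} [AddCommGroup M] [Module B M] {n : ℕ}

/-- A family `ω` indexed by the subsets of `{1, …, n}` stands for the inhomogeneous form
`∑ ω_S dt_S/t_S`, where `dt_S/t_S` is the wedge product of the `dt_i/t_i`, `i ∈ S`, in increasing
order. This is the operator `m dt_S/t_S ↦ ∑ i, D_i(m) dt_i/t_i ∧ dt_S/t_S`. -/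
def totalD (D : Fin n → Module.End B M) :
    (Finset (Fin n) → M) →ₗ[B] (Finset (Fin n) → M) :=
  LinearMap.pi fun T => ∑ i ∈ T,
    (-1 : B) ^ (T.filter (· < i)).card • (D i ∘ₗ LinearMap.proj (T.erase i))

theorem totalD_sq (D : Fin n → Module.End B M)
    (hD : ∀ i j m, D i (D j m) = D j (D i m)) (ω : Finset (Fin n) → M) :
    totalD D (totalD D ω) = 0 := by
  funext T
  simp only [totalD, LinearMap.pi_apply, LinearMap.sum_apply, LinearMap.smul_apply,
    LinearMap.comp_apply, LinearMap.proj_apply, map_sum, map_smul, Finset.smul_sum, Pi.zero_apply]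
  rw [Finset.sum_sigma']
  refine Finset.sum_involution (fun x _ => ⟨x.2, x.1⟩) ?_ ?_ ?_ ?_
  · rintro ⟨i, j⟩ h
    simp only [Finset.mem_sigma, Finset.mem_erase] at h
    obtain ⟨hi, hji, hj⟩ := h
    have key : ∀ a b : Fin n, a ∈ T → a < b →
        (T.filter (· < b)).card = ((T.erase a).filter (· < b)).card + 1 ∧
        ((T.erase b).filter (· < a)) = (T.filter (· < a)) := by
      intro a b ha hab
      constructor
      · rw [Finset.filter_erase, Finset.card_erase_add_one]
        simp [ha, hab]
      · rw [Finset.filter_erase, Finset.erase_eq_of_notMem]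
        simp [hab.le]
    have he : (T.erase j).erase i = (T.erase i).erase j := Finset.erase_right_comm
    simp only [he, hD j i]
    rcases lt_or_gt_of_ne hji with h | h
    · obtain ⟨h1, h2⟩ := key j i hj h
      rw [h1, h2]
      simp only [smul_smul, ← add_smul]
      convert zero_smul B _
      ring
    · obtain ⟨h1, h2⟩ := key i j hi h
      rw [h1, h2]
      simp only [smul_smul, ← add_smul]
      convert zero_smul B _
      ring
  · rintro ⟨i, j⟩ h _ he
    simp only [Finset.mem_sigma, Finset.mem_erase] at h
    simp only [Sigma.mk.injEq, heq_eq_eq] at he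
    exact h.2.1 he.1
  · rintro ⟨i, j⟩ h
    simp only [Finset.mem_sigma, Finset.mem_erase] at h ⊢
    exact ⟨h.2.2, fun e => h.2.1 e.symm, h.1⟩
  · rintro ⟨i, j⟩ h
    rfl

/-- The index set of the basis `dt_S/t_S` of the logarithmic `k`-forms; it is empty for `k < 0`
and for `k > n`. -/
abbrev FormIndex (n : ℕ) (k : ℤ) : Type := {S : Finset (Fin n) // (S.card : ℤ) = k}

/-- Extension by zero of a `k`-form to an inhomogeneous form. -/
def extendForm (B M : Type*) [CommRing B] [AddCommGroup M] [Module B M] (n : ℕ) (k : ℤ) :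
    (FormIndex n k → M) →ₗ[B] (Finset (Fin n) → M) :=
  LinearMap.pi fun S => if h : (S.card : ℤ) = k then LinearMap.proj ⟨S, h⟩ else 0

/-- The component of degree `k` of an inhomogeneous form. -/
def formPart (B M : Type*) [CommRing B] [AddCommGroup M] [Module B M] (n : ℕ) (k : ℤ) :
    (Finset (Fin n) → M) →ₗ[B] (FormIndex n k → M) :=
  LinearMap.pi fun S => LinearMap.proj S.1

/-- The differential
`∑ f_S dt_S/t_S ↦ ∑ i, ∑ S, D_i(f_S) dt_i/t_i ∧ dt_S/t_S` from `k`-forms to `(k+1)`-forms. -/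
def formD (D : Fin n → Module.End B M) (k : ℤ) :
    (FormIndex n k → M) →ₗ[B] (FormIndex n (k + 1) → M) :=
  formPart B M n (k + 1) ∘ₗ totalD D ∘ₗ extendForm B M n k

theorem formD_formD (D : Fin n → Module.End B M)
    (hD : ∀ i j m, D i (D j m) = D j (D i m)) (k : ℤ) (ω : FormIndex n k → M) :
    formD D (k + 1) (formD D k ω) = 0 := by
  have key : extendForm B M n (k + 1) (formPart B M n (k + 1) (totalD D (extendForm B M n k ω))) =
      totalD D (extendForm B M n k ω) := by
    funext T
    by_cases h : (T.card : ℤ) = k + 1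
    · simp [extendForm, formPart, h]
    · simp only [extendForm, LinearMap.pi_apply, dif_neg h, LinearMap.zero_apply, totalD,
        LinearMap.sum_apply, LinearMap.smul_apply, LinearMap.comp_apply, LinearMap.proj_apply]
      refine (Finset.sum_eq_zero fun i hi => ?_).symm
      have h' : ¬ (((T.erase i).card : ℤ) = k) := by
        have := Finset.card_erase_add_one hi
        omega
      simp [dif_neg h']
  simp only [formD, LinearMap.comp_apply]
  rw [key, totalD_sq D hD, map_zero]

/-- The complex of logarithmic forms `∑ f_S dt_S/t_S` with coefficients in `M` whose differential
is given by commuting `B`-linear operators `D_1, …, D_n` on `M`. -/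
def formComplex (B : Type u) [CommRing B] (M : Type u) [AddCommGroup M] [Module B M] {n : ℕ}
    (D : Fin n → Module.End B M) (hD : ∀ i j m, D i (D j m) = D j (D i m)) :
    CochainComplex (ModuleCat.{u} B) ℤ :=
  CochainComplex.of (fun k => ModuleCat.of B (FormIndex n k → M))
    (fun k => ModuleCat.ofHom (formD D k))
    (fun k => by
      refine ModuleCat.hom_ext (LinearMap.ext fun ω => ?_)
      exact formD_formD D hD k ω)

instance formComplex_isStrictlyLE (B : Type u) [CommRing B] (M : Type u) [AddCommGroup M]
    [Module B M] {n : ℕ} (D : Fin n → Module.End B M)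
    (hD : ∀ i j m, D i (D j m) = D j (D i m)) :
    (formComplex B M D hD).IsStrictlyLE (n : ℤ) := by
  rw [CochainComplex.isStrictlyLE_iff]
  intro i hi
  have : IsEmpty (FormIndex n i) := ⟨fun S => by
    have h1 := S.2
    have h2 := Finset.card_le_univ S.1
    simp only [Fintype.card_fin] at h2
    omega⟩
  have : Subsingleton (FormIndex n i → M) := inferInstance
  exact ModuleCat.isZero_of_subsingleton (ModuleCat.of B (FormIndex n i → M))

end Forms

/-! ### The cone, the Newton polytope and the weight function -/

section Weight

variable {n N : ℕ}

/-- The inclusion of `ℤⁿ` in `ℝⁿ`. -/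
def toReal (u : Fin n → ℤ) : Fin n → ℝ := fun i => (u i : ℝ)

/-- The convex hull `Δ` of the origin and the columns of `A`. -/
def newtonPolytope (A : Matrix (Fin n) (Fin N) ℤ) : Set (Fin n → ℝ) :=
  convexHull ℝ (insert 0 (Set.range fun j => toReal (A.col j)))

/-- The convex polyhedral cone `δ` generated by the columns of `A`. -/
def newtonCone (A : Matrix (Fin n) (Fin N) ℤ) : PointedCone ℝ (Fin n → ℝ) :=
  PointedCone.hull ℝ (Set.range fun j => toReal (A.col j))

/-- The weight `d(u) = inf {a > 0 | u ∈ a Δ}` (for `u` in the cone `δ`). -/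
noncomputable def weight (A : Matrix (Fin n) (Fin N) ℤ) (u : Fin n → ℝ) : ℝ :=
  sInf {a : ℝ | 0 < a ∧ u ∈ a • newtonPolytope A}

theorem weight_nonneg (A : Matrix (Fin n) (Fin N) ℤ) (u : Fin n → ℝ) : 0 ≤ weight A u :=
  Real.sInf_nonneg fun _ ha => ha.1.le

theorem toReal_zero : toReal (0 : Fin n → ℤ) = 0 := by
  funext i
  simp [toReal]

theorem weight_set_nonempty (A : Matrix (Fin n) (Fin N) ℤ) {u : Fin n → ℝ}
    (hu : u ∈ newtonCone A) : {a : ℝ | 0 < a ∧ u ∈ a • newtonPolytope A}.Nonempty := by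
  have hconv : Convex ℝ (newtonPolytope A) := convex_convexHull _ _
  have h0 : (0 : Fin n → ℝ) ∈ newtonPolytope A :=
    subset_convexHull _ _ (Set.mem_insert _ _)
  have hz : ({a : ℝ | 0 < a ∧ (0 : Fin n → ℝ) ∈ a • newtonPolytope A}).Nonempty :=
    ⟨1, one_pos, by simpa using h0⟩
  refine Submodule.span_induction
    (p := fun x _ => {a : ℝ | 0 < a ∧ x ∈ a • newtonPolytope A}.Nonempty) ?_ hz ?_ ?_ hu
  · intro x hx
    refine ⟨1, one_pos, ?_⟩
    rw [one_smul]
    exact subset_convexHull ℝ _ (Set.mem_insert_of_mem _ hx)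
  · rintro x y _ _ ⟨a, ha, hxa⟩ ⟨b, hb, hyb⟩
    refine ⟨a + b, add_pos ha hb, ?_⟩
    rw [hconv.add_smul ha.le hb.le]
    exact Set.add_mem_add hxa hyb
  · rintro ⟨c, hc⟩ x _ ⟨a, ha, hxa⟩
    rcases hc.eq_or_lt with rfl | hc'
    · have : (⟨0, hc⟩ : {c : ℝ // 0 ≤ c}) • x = 0 := zero_smul ℝ x
      rw [this]
      exact hz
    · refine ⟨c * a, mul_pos hc' ha, ?_⟩
      rw [mul_smul]
      exact Set.smul_mem_smul_set hxa

theorem weight_add_col_le (A : Matrix (Fin n) (Fin N) ℤ) {u : Fin n → ℝ}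
    (hu : u ∈ newtonCone A) (j : Fin N) : weight A (u + toReal (A.col j)) ≤ weight A u + 1 := by
  have hconv : Convex ℝ (newtonPolytope A) := convex_convexHull _ _
  rw [← sub_le_iff_le_add]
  refine le_csInf (weight_set_nonempty A hu) ?_
  rintro a ⟨ha, hua⟩
  rw [sub_le_iff_le_add]
  refine csInf_le ⟨0, fun b hb => hb.1.le⟩ ⟨by positivity, ?_⟩
  rw [hconv.add_smul ha.le zero_le_one, one_smul]
  exact Set.add_mem_add hua (subset_convexHull ℝ _ (Set.mem_insert_of_mem _ ⟨j, rfl⟩))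

theorem weight_le_sub_col (A : Matrix (Fin n) (Fin N) ℤ) (u : Fin n → ℤ) (j : Fin N)
    (hu : toReal (u - A.col j) ∈ newtonCone A) :
    weight A (toReal u) ≤ weight A (toReal (u - A.col j)) + 1 := by
  have h := weight_add_col_le A hu j
  have e : toReal (u - A.col j) + toReal (A.col j) = toReal u := by
    funext i
    simp [toReal]
  rwa [e] at h

theorem mem_newtonCone_of_sub_col (A : Matrix (Fin n) (Fin N) ℤ) (u : Fin n → ℤ) (j : Fin N)
    (hu : toReal (u - A.col j) ∈ newtonCone A) : toReal u ∈ newtonCone A := by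
  have e : toReal (u - A.col j) + toReal (A.col j) = toReal u := by
    funext i
    simp [toReal]
  rw [← e]
  exact Submodule.add_mem _ hu (Submodule.subset_span ⟨j, rfl⟩)

end Weight

/-! ### The twisted logarithmic derivations on formal series in `t` -/

section Twisted

variable {n N : ℕ} {B : Type*} [CommRing B] {V : Type*} [AddCommGroup V] [Module B V]

/-- On formal series `g = ∑ g_u t^u` (families indexed by `u ∈ ℤⁿ`), the operator
`D_i = t_i ∂/∂t_i + γ_i + ∑ j, w_{ij} c_j t^{w_j}`, where `w_j` is the `j`-th column of `A`. -/
def twistedDeriv (A : Matrix (Fin n) (Fin N) ℤ) (γ : Fin n → B) (c : Fin N → B) (i : Fin n) :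
    Module.End B ((Fin n → ℤ) → V) where
  toFun g := fun u => u i • g u + γ i • g u + ∑ j, A i j • c j • g (u - A.col j)
  map_add' g h := by
    funext u
    simp only [Pi.add_apply, smul_add, Finset.sum_add_distrib]
    abel
  map_smul' b g := by
    funext u
    simp only [Pi.smul_apply, RingHom.id_apply, smul_add, Finset.smul_sum]
    congr 1
    · congr 1
      · exact smul_comm _ _ _
      · exact smul_comm _ _ _
    · refine Finset.sum_congr rfl fun j _ => ?_
      rw [smul_comm b (A i j), smul_comm b (c j)]

theorem twistedDeriv_twistedDeriv (A : Matrix (Fin n) (Fin N) ℤ) (γ : Fin n → B)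
    (c : Fin N → B) (i k : Fin n) (g : (Fin n → ℤ) → V) (u : Fin n → ℤ) :
    twistedDeriv A γ c i (twistedDeriv A γ c k g) u =
      (((u i : B) + γ i) * ((u k : B) + γ k)) • g u +
      ∑ j, ((((u i : B) + γ i) * (A k j : B) + (A i j : B) * ((u k : B) + γ k) -
        (A i j : B) * (A k j : B)) * c j) • g (u - A.col j) +
      ∑ j, ∑ l, ((A i j : B) * c j * ((A k l : B) * c l)) • g (u - A.col j - A.col l) := by
  have merge : ∀ (a b : V) (f₁ f₂ f₃ : Fin N → V),
      (a + ∑ j, f₁ j) + (b + ∑ j, f₂ j) + ∑ j, f₃ j = (a + b) + ∑ j, (f₁ j + f₂ j + f₃ j) := by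
    intro a b f₁ f₂ f₃
    simp only [Finset.sum_add_distrib]
    abel
  simp only [twistedDeriv, LinearMap.coe_mk, AddHom.coe_mk, ← Int.cast_smul_eq_zsmul B]
  rw [smul_add, smul_add (γ i), Finset.smul_sum, Finset.smul_sum, merge]
  conv_rhs => rw [add_assoc, ← Finset.sum_add_distrib]
  congr 1
  · module
  · refine Finset.sum_congr rfl fun j _ => ?_
    have hl : ∑ l, ((A i j : B) * c j * ((A k l : B) * c l)) • g (u - A.col j - A.col l) =
        ((A i j : B) * c j) • ∑ l, (A k l : B) • c l • g (u - A.col j - A.col l) := by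
      rw [Finset.smul_sum]
      exact Finset.sum_congr rfl fun l _ => by simp only [smul_smul]
    rw [hl]
    simp only [Pi.sub_apply, Matrix.col_apply, Int.cast_sub]
    module

theorem twistedDeriv_comm (A : Matrix (Fin n) (Fin N) ℤ) (γ : Fin n → B) (c : Fin N → B)
    (i k : Fin n) (g : (Fin n → ℤ) → V) :
    twistedDeriv A γ c i (twistedDeriv A γ c k g) =
      twistedDeriv A γ c k (twistedDeriv A γ c i g) := by
  funext u
  rw [twistedDeriv_twistedDeriv, twistedDeriv_twistedDeriv]
  congr 1
  · congr 1
    · rw [mul_comm]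
    · refine Finset.sum_congr rfl fun j _ => ?_
      congr 1
      ring
  · rw [Finset.sum_comm]
    refine Finset.sum_congr rfl fun j _ => Finset.sum_congr rfl fun l _ => ?_
    rw [sub_right_comm, mul_comm]

theorem twistedDeriv_mem (A : Matrix (Fin n) (Fin N) ℤ) (γ : Fin n → B) (c : Fin N → B)
    (S : Submodule B ((Fin n → ℤ) → V))
    (hθ : ∀ (i : Fin n), ∀ g ∈ S, (fun u => u i • g u) ∈ S)
    (hshift : ∀ (j : Fin N), ∀ g ∈ S, (fun u => g (u - A.col j)) ∈ S)
    (i : Fin n) : ∀ g ∈ S, twistedDeriv A γ c i g ∈ S := by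
  intro g hg
  have e : twistedDeriv A γ c i g = (fun u => u i • g u) + γ i • g +
      ∑ j, A i j • c j • (fun u => g (u - A.col j)) := by
    funext u
    simp [twistedDeriv, Finset.sum_apply]
  rw [e]
  exact S.add_mem (S.add_mem (hθ i g hg) (S.smul_mem _ hg))
    (S.sum_mem fun j _ => S.smul_of_tower_mem _ (S.smul_mem _ (hshift j g hg)))

end Twisted

/-! ### Overconvergent series over a finite extension of `ℚ_[p]` -/

section Overconvergent

variable (p : ℕ) [Fact p.Prime] (K : Type u) [NormedField K] [NormedAlgebra ℚ_[p] K]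

theorem isUltrametricDist_of_padic (p : ℕ) [Fact p.Prime] (K : Type u) [NormedField K]
    [NormedAlgebra ℚ_[p] K] :
    IsUltrametricDist K := by
  refine IsUltrametricDist.isUltrametricDist_of_forall_norm_natCast_le_one fun n => ?_
  have h : ((n : ℚ_[p]) : ℚ_[p]) = ((n : ℤ) : ℚ_[p]) := by simp
  rw [← map_natCast (algebraMap ℚ_[p] K) n, norm_algebraMap', h]
  exact Padic.norm_int_le_one n

theorem norm_zsmul_le_of_padic (p : ℕ) [Fact p.Prime] (K : Type u) [NormedField K]
    [NormedAlgebra ℚ_[p] K] (m : ℤ) (x : K) : ‖m • x‖ ≤ ‖x‖ := by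
  have h := isUltrametricDist_of_padic p K
  rw [zsmul_eq_mul, norm_mul]
  exact mul_le_of_le_one_left (norm_nonneg _) (IsUltrametricDist.norm_intCast_le_one K m)

/-- The ring `K⟨x⟩†` of overconvergent power series in `x_1, …, x_N`: the series `∑ a_v x^v` such
that `|a_v| r^|v|` is bounded for some `r > 1`. -/
def Dagger (N : ℕ) : Subalgebra K (MvPowerSeries (Fin N) K) where
  carrier := {f | ∃ r : ℝ, 1 < r ∧ ∃ C : ℝ, ∀ v : Fin N →₀ ℕ,
    ‖MvPowerSeries.coeff v f‖ * r ^ v.degree ≤ C}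
  mul_mem' := by
    rintro f g ⟨r₁, hr₁, C₁, h₁⟩ ⟨r₂, hr₂, C₂, h₂⟩
    have hu := isUltrametricDist_of_padic p K
    have hC₁ : 0 ≤ C₁ := le_trans (by positivity) (h₁ 0)
    have hC₂ : 0 ≤ C₂ := le_trans (by positivity) (h₂ 0)
    refine ⟨min r₁ r₂, lt_min hr₁ hr₂, C₁ * C₂, fun v => ?_⟩
    have hr : 0 < min r₁ r₂ := lt_trans one_pos (lt_min hr₁ hr₂)
    rw [← le_div_iff₀ (by positivity), MvPowerSeries.coeff_mul]
    refine IsUltrametricDist.norm_sum_le_of_forall_le_of_nonneg (by positivity) ?_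
    rintro ⟨a, b⟩ hab
    rw [Finset.HasAntidiagonal.mem_antidiagonal] at hab
    rw [le_div_iff₀ (by positivity), ← hab, map_add, pow_add, norm_mul]
    calc _ = (‖MvPowerSeries.coeff a f‖ * min r₁ r₂ ^ a.degree) *
          (‖MvPowerSeries.coeff b g‖ * min r₁ r₂ ^ b.degree) := by ring
      _ ≤ (‖MvPowerSeries.coeff a f‖ * r₁ ^ a.degree) *
          (‖MvPowerSeries.coeff b g‖ * r₂ ^ b.degree) := by
        gcongr
        · exact min_le_left _ _
        · exact min_le_right _ _
      _ ≤ C₁ * C₂ := by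
        gcongr
        · exact h₁ a
        · exact h₂ b
  add_mem' := by
    rintro f g ⟨r₁, hr₁, C₁, h₁⟩ ⟨r₂, hr₂, C₂, h₂⟩
    refine ⟨min r₁ r₂, lt_min hr₁ hr₂, C₁ + C₂, fun v => ?_⟩
    have hr : 0 < min r₁ r₂ := lt_trans one_pos (lt_min hr₁ hr₂)
    rw [map_add]
    calc _ ≤ (‖MvPowerSeries.coeff v f‖ + ‖MvPowerSeries.coeff v g‖) * min r₁ r₂ ^ v.degree := by
          gcongr
          exact norm_add_le _ _
      _ = ‖MvPowerSeries.coeff v f‖ * min r₁ r₂ ^ v.degree +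
          ‖MvPowerSeries.coeff v g‖ * min r₁ r₂ ^ v.degree := by ring
      _ ≤ ‖MvPowerSeries.coeff v f‖ * r₁ ^ v.degree +
          ‖MvPowerSeries.coeff v g‖ * r₂ ^ v.degree := by
        gcongr
        · exact min_le_left _ _
        · exact min_le_right _ _
      _ ≤ C₁ + C₂ := add_le_add (h₁ v) (h₂ v)
  algebraMap_mem' := by
    intro a
    refine ⟨2, one_lt_two, ‖a‖, fun v => ?_⟩
    classical
    rw [MvPowerSeries.algebraMap_apply, Algebra.algebraMap_self, RingHom.id_apply,
      MvPowerSeries.coeff_C]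
    split_ifs with h
    · simp [h]
    · simp

/-- The variable `x_j` as an element of `K⟨x⟩†`. -/
noncomputable def Dagger.X {N : ℕ} (j : Fin N) : Dagger p K N :=
  ⟨MvPowerSeries.X j, 2, one_lt_two, 2, fun v => by
    classical
    rw [MvPowerSeries.coeff_X]
    split_ifs with h
    · simp [h]
    · simp⟩

variable {p K} in
theorem Dagger.summable {K' : Type u} [NormedField K'] [NormedAlgebra ℚ_[p] K']
    [CompleteSpace K'] [NormedAlgebra K K'] {N : ℕ} (a : Fin N → K') (ha : ∀ j, ‖a j‖ ≤ 1)
    (f : Dagger p K N) :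
    Summable fun v : Fin N →₀ ℕ =>
      algebraMap K K' (MvPowerSeries.coeff v f.1) * ∏ j, a j ^ v j := by
  have hu := isUltrametricDist_of_padic p K'
  obtain ⟨f, r, hr, C, hC⟩ := f
  have hr0 : 0 < r := one_pos.trans hr
  have hC0 : 0 ≤ C := le_trans (by positivity) (hC 0)
  refine NonarchimedeanAddGroup.summable_of_tendsto_cofinite_zero ?_
  rw [tendsto_zero_iff_norm_tendsto_zero]
  have hdeg : Filter.Tendsto (fun v : Fin N →₀ ℕ => v.degree) Filter.cofinite Filter.atTop := by
    rw [Filter.tendsto_atTop]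
    intro m
    refine (Finsupp.finite_of_degree_le (σ := Fin N) m).subset fun v hv => ?_
    simp only [Set.mem_compl_iff, Set.mem_ofPred_eq, not_le] at hv ⊢
    exact hv.le
  have h0 : Filter.Tendsto (fun v : Fin N →₀ ℕ => C * r⁻¹ ^ v.degree) Filter.cofinite
      (nhds 0) := by
    have := ((tendsto_pow_atTop_nhds_zero_of_lt_one (inv_nonneg.2 hr0.le)
      (inv_lt_one_of_one_lt₀ hr)).comp hdeg).const_mul C
    simpa using this
  refine squeeze_zero (fun v => norm_nonneg _) (fun v => ?_) h0
  rw [norm_mul, norm_algebraMap', norm_prod, inv_pow, ← div_eq_mul_inv]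
  have h1 : ∏ j, ‖a j ^ v j‖ ≤ 1 := Finset.prod_le_one (fun _ _ => norm_nonneg _) fun j _ => by
    rw [norm_pow]
    exact pow_le_one₀ (norm_nonneg _) (ha j)
  refine (mul_le_of_le_one_right (norm_nonneg _) h1).trans ?_
  rw [le_div_iff₀ (by positivity)]
  exact hC v

variable {p K} in
theorem Dagger.tsum_mul {K' : Type u} [NormedField K'] [NormedAlgebra ℚ_[p] K']
    [CompleteSpace K'] [NormedAlgebra K K'] {N : ℕ} (a : Fin N → K') (ha : ∀ j, ‖a j‖ ≤ 1)
    (f g : Dagger p K N) :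
    ∑' v : Fin N →₀ ℕ, algebraMap K K' (MvPowerSeries.coeff v (f * g).1) * ∏ j, a j ^ v j =
      (∑' v : Fin N →₀ ℕ, algebraMap K K' (MvPowerSeries.coeff v f.1) * ∏ j, a j ^ v j) *
      ∑' v : Fin N →₀ ℕ, algebraMap K K' (MvPowerSeries.coeff v g.1) * ∏ j, a j ^ v j := by
  have hu : IsUltrametricDist K' := isUltrametricDist_of_padic p K'
  have hf := Dagger.summable a ha f
  have hg := Dagger.summable a ha g
  have hR : NonarchimedeanRing K' := { is_nonarchimedean := NonarchimedeanAddGroup.is_nonarchimedean }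
  have hfg := Summable.mul_of_nonarchimedean hf hg
  refine Eq.trans ?_ (Summable.tsum_mul_tsum_eq_tsum_sum_antidiagonal hf hg hfg).symm
  refine tsum_congr fun v => ?_
  have h : MvPowerSeries.coeff v (f * g).1 = _ := MvPowerSeries.coeff_mul v f.1 g.1
  rw [h, map_sum, Finset.sum_mul]
  refine Finset.sum_congr rfl fun x hx => ?_
  rw [Finset.HasAntidiagonal.mem_antidiagonal] at hx
  have hp : ∏ j, a j ^ v j = (∏ j, a j ^ x.1 j) * ∏ j, a j ^ x.2 j := by
    rw [← Finset.prod_mul_distrib, ← hx]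
    exact Finset.prod_congr rfl fun j _ => by rw [Finsupp.add_apply, pow_add]
  rw [hp, RingHom.map_mul]
  ring

/-- The homomorphism `K⟨x⟩† → K'`, `f ↦ f(a)`, for a point `a` of the closed unit polydisc with
coordinates in a finite extension `K'` of `K`. -/
noncomputable def Dagger.eval [FiniteDimensional ℚ_[p] K] (K' : Type u) [NormedField K']
    [NormedAlgebra ℚ_[p] K'] [NormedAlgebra K K'] [IsScalarTower ℚ_[p] K K']
    [FiniteDimensional K K'] {N : ℕ} (a : Fin N → K') (ha : ∀ j, ‖a j‖ ≤ 1) :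
    Dagger p K N →+* K' :=
  have : FiniteDimensional ℚ_[p] K' := FiniteDimensional.trans ℚ_[p] K K'
  have : CompleteSpace K' := FiniteDimensional.complete ℚ_[p] K'
  have hu : IsUltrametricDist K' := isUltrametricDist_of_padic p K'
  { toFun := fun f => ∑' v : Fin N →₀ ℕ,
      algebraMap K K' (MvPowerSeries.coeff v f.1) * ∏ j, a j ^ v j
    map_one' := by
      classical
      rw [tsum_eq_single 0]
      · simp
      · intro v hv
        simp [MvPowerSeries.coeff_one, hv]
    map_zero' := by simp
    map_add' := fun f g => by
      rw [← (Dagger.summable a ha f).tsum_add (Dagger.summable a ha g)]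
      refine tsum_congr fun v => ?_
      have h : MvPowerSeries.coeff v (f + g).1 =
          MvPowerSeries.coeff v f.1 + MvPowerSeries.coeff v g.1 := rfl
      rw [h, RingHom.map_add, add_mul]
    map_mul' := fun f g => Dagger.tsum_mul a ha f g }

variable {n N : ℕ} (A : Matrix (Fin n) (Fin N) ℤ)

/-- The `K⟨x⟩†`-module `L†` of series `∑ g_w(x) t^w`, `w ∈ ℤⁿ ∩ δ`, such that, for some `r > 1`
and `s > 1`, the quantities `|a_{vw}| r^|v| s^d(w)` are bounded, where `a_{vw}` is the coefficient
of `x^v` in `g_w(x)`. -/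
noncomputable def LDagger : Submodule (Dagger p K N) ((Fin n → ℤ) → MvPowerSeries (Fin N) K) where
  carrier := {g | (∀ w, toReal w ∉ newtonCone A → g w = 0) ∧
    ∃ r : ℝ, 1 < r ∧ ∃ s : ℝ, 1 < s ∧ ∃ C : ℝ, ∀ (v : Fin N →₀ ℕ) (w : Fin n → ℤ),
      toReal w ∈ newtonCone A →
        ‖MvPowerSeries.coeff v (g w)‖ * r ^ v.degree * s ^ weight A (toReal w) ≤ C}
  zero_mem' := ⟨fun _ _ => rfl, 2, one_lt_two, 2, one_lt_two, 0, fun v w _ => by simp⟩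
  add_mem' := by
    rintro f g ⟨hf0, r₁, hr₁, s₁, hs₁, C₁, h₁⟩ ⟨hg0, r₂, hr₂, s₂, hs₂, C₂, h₂⟩
    refine ⟨fun w hw => by simp [hf0 w hw, hg0 w hw], min r₁ r₂, lt_min hr₁ hr₂, min s₁ s₂,
      lt_min hs₁ hs₂, C₁ + C₂, fun v w hw => ?_⟩
    have hr : 0 < min r₁ r₂ := lt_trans one_pos (lt_min hr₁ hr₂)
    have hs : 0 < min s₁ s₂ := lt_trans one_pos (lt_min hs₁ hs₂)
    have hd : 0 ≤ weight A (toReal w) := weight_nonneg A _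
    have hr₁0 : 0 < r₁ := one_pos.trans hr₁
    have hr₂0 : 0 < r₂ := one_pos.trans hr₂
    rw [Pi.add_apply, map_add]
    calc _ ≤ (‖MvPowerSeries.coeff v (f w)‖ + ‖MvPowerSeries.coeff v (g w)‖) *
            min r₁ r₂ ^ v.degree * min s₁ s₂ ^ weight A (toReal w) := by
          gcongr
          exact norm_add_le _ _
      _ = ‖MvPowerSeries.coeff v (f w)‖ * min r₁ r₂ ^ v.degree *
            min s₁ s₂ ^ weight A (toReal w) +
          ‖MvPowerSeries.coeff v (g w)‖ * min r₁ r₂ ^ v.degree *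
            min s₁ s₂ ^ weight A (toReal w) := by ring
      _ ≤ ‖MvPowerSeries.coeff v (f w)‖ * r₁ ^ v.degree * s₁ ^ weight A (toReal w) +
          ‖MvPowerSeries.coeff v (g w)‖ * r₂ ^ v.degree * s₂ ^ weight A (toReal w) := by
        gcongr
        · exact min_le_left _ _
        · exact min_le_left _ _
        · exact min_le_right _ _
        · exact min_le_right _ _
      _ ≤ C₁ + C₂ := add_le_add (h₁ v w hw) (h₂ v w hw)
  smul_mem' := by
    rintro ⟨b, r₁, hr₁, C₁, h₁⟩ g ⟨hg0, r₂, hr₂, s, hs, C₂, h₂⟩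
    have hu := isUltrametricDist_of_padic p K
    have hs0 : 0 < s := one_pos.trans hs
    have hr : 0 < min r₁ r₂ := lt_trans one_pos (lt_min hr₁ hr₂)
    have hC₁ : 0 ≤ C₁ := le_trans (by positivity) (h₁ 0)
    have hC₂ : 0 ≤ C₂ :=
      le_trans (by positivity) (h₂ 0 0 (by rw [toReal_zero]; exact zero_mem _))
    refine ⟨fun w hw => by simp [hg0 w hw], min r₁ r₂, lt_min hr₁ hr₂, s, hs, C₁ * C₂,
      fun v w hw => ?_⟩
    change ‖MvPowerSeries.coeff v (b * g w)‖ * _ * _ ≤ _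
    rw [mul_assoc, ← le_div_iff₀ (by positivity), MvPowerSeries.coeff_mul]
    refine IsUltrametricDist.norm_sum_le_of_forall_le_of_nonneg (by positivity) ?_
    rintro ⟨x, y⟩ hxy
    rw [Finset.HasAntidiagonal.mem_antidiagonal] at hxy
    rw [le_div_iff₀ (by positivity), ← hxy, map_add, pow_add, norm_mul]
    calc _ = (‖MvPowerSeries.coeff x b‖ * min r₁ r₂ ^ x.degree) *
          (‖MvPowerSeries.coeff y (g w)‖ * min r₁ r₂ ^ y.degree * s ^ weight A (toReal w)) := by
          ring
      _ ≤ (‖MvPowerSeries.coeff x b‖ * r₁ ^ x.degree) *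
          (‖MvPowerSeries.coeff y (g w)‖ * r₂ ^ y.degree * s ^ weight A (toReal w)) := by
        gcongr
        · exact min_le_left _ _
        · exact min_le_right _ _
      _ ≤ C₁ * C₂ := by
        gcongr
        · exact h₁ x
        · exact h₂ y w hw

/-- The `K`-vector space of series `∑ a_w t^w`, `w ∈ ℤⁿ ∩ δ`, with `a_w ∈ K`, such that
`|a_w| s^d(w)` is bounded for some `s > 1`. -/
noncomputable def LZeroDagger : Submodule K ((Fin n → ℤ) → K) where
  carrier := {g | (∀ w, toReal w ∉ newtonCone A → g w = 0) ∧
    ∃ s : ℝ, 1 < s ∧ ∃ C : ℝ, ∀ w : Fin n → ℤ, toReal w ∈ newtonCone A →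
      ‖g w‖ * s ^ weight A (toReal w) ≤ C}
  zero_mem' := ⟨fun _ _ => rfl, 2, one_lt_two, 0, fun w _ => by simp⟩
  add_mem' := by
    rintro f g ⟨hf0, s₁, hs₁, C₁, h₁⟩ ⟨hg0, s₂, hs₂, C₂, h₂⟩
    refine ⟨fun w hw => by simp [hf0 w hw, hg0 w hw], min s₁ s₂,
      lt_min hs₁ hs₂, C₁ + C₂, fun w hw => ?_⟩
    have hs : 0 < min s₁ s₂ := lt_trans one_pos (lt_min hs₁ hs₂)
    have hd : 0 ≤ weight A (toReal w) := weight_nonneg A _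
    rw [Pi.add_apply]
    calc _ ≤ (‖f w‖ + ‖g w‖) * min s₁ s₂ ^ weight A (toReal w) := by
          gcongr
          exact norm_add_le _ _
      _ = ‖f w‖ * min s₁ s₂ ^ weight A (toReal w) + ‖g w‖ * min s₁ s₂ ^ weight A (toReal w) := by
          ring
      _ ≤ ‖f w‖ * s₁ ^ weight A (toReal w) + ‖g w‖ * s₂ ^ weight A (toReal w) := by
        gcongr
        · exact min_le_left _ _
        · exact min_le_right _ _
      _ ≤ C₁ + C₂ := add_le_add (h₁ w hw) (h₂ w hw)
  smul_mem' := by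
    rintro b g ⟨hg0, s, hs, C, h⟩
    refine ⟨fun w hw => by simp [hg0 w hw], s, hs, ‖b‖ * C, fun w hw => ?_⟩
    rw [Pi.smul_apply, smul_eq_mul, norm_mul, mul_assoc]
    gcongr
    exact h w hw

theorem LDagger_theta (i : Fin n) : ∀ g ∈ LDagger p K A, (fun w => w i • g w) ∈ LDagger p K A := by
  rintro g ⟨hg0, r, hr, s, hs, C, h⟩
  have hs0 : 0 < s := one_pos.trans hs
  have hr0 : 0 < r := one_pos.trans hr
  refine ⟨fun w hw => by simp [hg0 w hw], r, hr, s, hs, C, fun v w hw => ?_⟩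
  refine le_trans ?_ (h v w hw)
  rw [map_zsmul]
  gcongr
  exact norm_zsmul_le_of_padic p K _ _

theorem LDagger_shift (j : Fin N) :
    ∀ g ∈ LDagger p K A, (fun w => g (w - A.col j)) ∈ LDagger p K A := by
  rintro g ⟨hg0, r, hr, s, hs, C, h⟩
  have hs0 : 0 < s := one_pos.trans hs
  have hr0 : 0 < r := one_pos.trans hr
  have hC : 0 ≤ C := le_trans (by positivity) (h 0 0 (by rw [toReal_zero]; exact zero_mem _))
  refine ⟨fun w hw => hg0 _ fun h' => hw (mem_newtonCone_of_sub_col A w j h'), r, hr, s, hs,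
    C * s, fun v w hw => ?_⟩
  by_cases hw' : toReal (w - A.col j) ∈ newtonCone A
  · calc _ ≤ ‖MvPowerSeries.coeff v (g (w - A.col j))‖ * r ^ v.degree *
          s ^ (weight A (toReal (w - A.col j)) + 1) := by
          gcongr
          · exact hs.le
          · exact weight_le_sub_col A w j hw'
      _ = (‖MvPowerSeries.coeff v (g (w - A.col j))‖ * r ^ v.degree *
          s ^ weight A (toReal (w - A.col j))) * s := by
          rw [Real.rpow_add hs0, Real.rpow_one]
          ring
      _ ≤ C * s := by
          gcongr
          exact h v _ hw'
  · simp only [hg0 _ hw', map_zero, norm_zero, zero_mul]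
    positivity

theorem LZeroDagger_theta (p : ℕ) [Fact p.Prime] (K : Type u) [NormedField K]
    [NormedAlgebra ℚ_[p] K]
    {n N : ℕ} (A : Matrix (Fin n) (Fin N) ℤ) (i : Fin n) :
    ∀ g ∈ LZeroDagger K A, (fun w => w i • g w) ∈ LZeroDagger K A := by
  rintro g ⟨hg0, s, hs, C, h⟩
  have hs0 : 0 < s := one_pos.trans hs
  refine ⟨fun w hw => by simp [hg0 w hw], s, hs, C, fun w hw => ?_⟩
  refine le_trans ?_ (h w hw)
  gcongr
  exact norm_zsmul_le_of_padic p K _ _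

theorem LZeroDagger_shift (j : Fin N) :
    ∀ g ∈ LZeroDagger K A, (fun w => g (w - A.col j)) ∈ LZeroDagger K A := by
  rintro g ⟨hg0, s, hs, C, h⟩
  have hs0 : 0 < s := one_pos.trans hs
  have hC : 0 ≤ C := le_trans (by positivity) (h 0 (by rw [toReal_zero]; exact zero_mem _))
  refine ⟨fun w hw => hg0 _ fun h' => hw (mem_newtonCone_of_sub_col A w j h'), s, hs,
    C * s, fun w hw => ?_⟩
  by_cases hw' : toReal (w - A.col j) ∈ newtonCone A
  · calc _ ≤ ‖g (w - A.col j)‖ * s ^ (weight A (toReal (w - A.col j)) + 1) := by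
          gcongr
          · exact hs.le
          · exact weight_le_sub_col A w j hw'
      _ = (‖g (w - A.col j)‖ * s ^ weight A (toReal (w - A.col j))) * s := by
          rw [Real.rpow_add hs0, Real.rpow_one]
          ring
      _ ≤ C * s := by
          gcongr
          exact h _ hw'
  · simp only [hg0 _ hw', norm_zero, zero_mul]
    positivity

/-- The operator `t_i ∂/∂t_i + γ_i + π ∑ j, w_{ij} x_j t^{w_j}` on `L†`. -/
noncomputable def LDagger.D (γ : Fin n → K) (π : K) (i : Fin n) :
    Module.End (Dagger p K N) (LDagger p K A) :=
  (twistedDeriv A (fun i => algebraMap K (Dagger p K N) (γ i))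
    (fun j => algebraMap K (Dagger p K N) π * Dagger.X p K j) i).restrict
    (twistedDeriv_mem A _ _ _ (LDagger_theta p K A) (LDagger_shift p K A) i)

/-- The operator `t_i ∂/∂t_i + γ_i + π ∑ j, w_{ij} a_j t^{w_j}` on `L₀†`. -/
noncomputable def LZeroDagger.D (γ : Fin n → K) (π : K) (a : Fin N → K) (i : Fin n) :
    Module.End K (LZeroDagger K A) :=
  (twistedDeriv A γ (fun j => π * a j) i).restrict
    (twistedDeriv_mem A _ _ _ (LZeroDagger_theta p K A) (LZeroDagger_shift K A) i)

theorem LDagger.D_comm (γ : Fin n → K) (π : K) (i k : Fin n) (g : LDagger p K A) :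
    LDagger.D p K A γ π i (LDagger.D p K A γ π k g) =
      LDagger.D p K A γ π k (LDagger.D p K A γ π i g) := by
  apply Subtype.ext
  simp only [LDagger.D, LinearMap.coe_restrict_apply]
  exact twistedDeriv_comm A _ _ i k g.1

theorem LZeroDagger.D_comm (γ : Fin n → K) (π : K) (a : Fin N → K) (i k : Fin n)
    (g : LZeroDagger K A) :
    LZeroDagger.D p K A γ π a i (LZeroDagger.D p K A γ π a k g) =
      LZeroDagger.D p K A γ π a k (LZeroDagger.D p K A γ π a i g) := by
  apply Subtype.ext
  simp only [LZeroDagger.D, LinearMap.coe_restrict_apply]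
  exact twistedDeriv_comm A _ _ i k g.1

/-- The twisted de Rham complex `C·(L†)`: the complex of `K⟨x⟩†`-modules of forms
`∑ f_S dt_S/t_S` with `f_S ∈ L†`, with the differential
`d = d_t + ∑ i, (γ_i + π ∑ j, w_{ij} x_j t^{w_j}) dt_i/t_i ∧`. -/
noncomputable def gkzComplex (γ : Fin n → K) (π : K) :
    CochainComplex (ModuleCat.{u} (Dagger p K N)) ℤ :=
  formComplex (Dagger p K N) (LDagger p K A) (LDagger.D p K A γ π)
    (LDagger.D_comm p K A γ π)

/-- The twisted de Rham complex `C·(L₀†)`: the complex of `K`-vector spaces of forms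
`∑ f_S dt_S/t_S` with `f_S ∈ L₀†`, with the differential
`d = d_t + ∑ i, (γ_i + π ∑ j, w_{ij} a_j t^{w_j}) dt_i/t_i ∧`. -/
noncomputable def gkzComplexAt (γ : Fin n → K) (π : K) (a : Fin N → K) :
    CochainComplex (ModuleCat.{u} K) ℤ :=
  formComplex K (LZeroDagger K A) (LZeroDagger.D p K A γ π a)
    (LZeroDagger.D_comm p K A γ π a)

noncomputable instance gkzComplex_isStrictlyLE (γ : Fin n → K) (π : K) :
    (gkzComplex p K A γ π).IsStrictlyLE (n : ℤ) :=
  formComplex_isStrictlyLE _ _ _ _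

/-- A complex of `C`-modules as a complex of `B`-modules via `φ : B → C`. -/
noncomputable def restrictComplex {B C : Type u} [CommRing B] [CommRing C] (φ : B →+* C)
    (X : CochainComplex (ModuleCat.{u} C) ℤ) : CochainComplex (ModuleCat.{u} B) ℤ :=
  ((ModuleCat.restrictScalars φ).mapHomologicalComplex (ComplexShape.up ℤ)).obj X

end Overconvergent

end PGKZ

namespace PGKZ

open MonoidalCategory

/-! ### Tensoring a quasi-isomorphism with a module -/

section TensorQuasiIso

variable {B : Type u} [CommRing B] {X Y : CochainComplex (ModuleCat.{u} B) ℤ}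

/-! Write B = K⟨x⟩†, B' = K'⟨x⟩† and L'† for the module L† formed over K'. Evaluation at the point a
factors as B → B' → K'. The first map makes B' a free B-module of finite rank, and L'† is the base
change of L† along it: coordinates with respect to a K-basis of K' are bounded linear forms, so they
preserve overconvergence (`Dagger.bijective_sum_smul`, `LDagger.bijective_sum_smul`). Over K' the
point a is rational, and the second map is the quotient by the elements c_j = X_j - a_j. These form
a regular sequence both on B' and on L'†, with quotients K' and L_0†.

Regularity comes from explicit division. Since |a_j| ≤ 1, a series can be divided by X_j - a_j with
a remainder free of x_j, and quotient and remainder satisfy the same coefficient bounds as the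
dividend, which is why the division also works in L'†. `Division` records the properties needed;
regularity in any order (`Division.mem_of_smul_mem`) and the description of the kernel of evaluation
(`Division.mem_of_map_eq_zero`) follow formally.

No flatness of L† over B is used. For a projective resolution P → C(L†), one shows that P ⊗ E →
C(L†) ⊗ E is a quasi-isomorphism for E = B'/(c_j : j ∈ s), by induction on s
(`TensorQuasiIso.quotient_span`). For s empty, E = B' is flat over B. Adjoining c_b uses the
sequence 0 → B'/I → B'/I → B'/(I + (c_b)) → 0 given by multiplication by c_b: it stays exact after
tensoring with P by flatness, and with C(L†) because c_b is regular on L'†/I L'†; the long exact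
homology sequences are then compared. When all c_j are used, E = K', and C(L†) ⊗ K' is C(L_0†) term
by term, since evaluation intertwines the operators D_i (`LDagger.evalHom_map_D`). -/

/-- The morphism of complexes `f ⊗ E` is a quasi-isomorphism. -/
def TensorQuasiIso (f : X ⟶ Y) (E : ModuleCat.{u} B) : Prop :=
  QuasiIso (((tensorRight E).mapHomologicalComplex (ComplexShape.up ℤ)).map f)

theorem TensorQuasiIso.of_flat (f : X ⟶ Y) [QuasiIso f] (E : ModuleCat.{u} B)
    [Module.Flat B E] : TensorQuasiIso f E := by
  -- Flatness supplies left exactness; right exactness is carried over from `tensorLeft E` by the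
  -- braiding.
  have : Limits.PreservesFiniteColimits (tensorRight E) :=
    Limits.preservesFiniteColimits_of_natIso (BraidedCategory.tensorLeftIsoTensorRight E)
  have : (tensorRight E).PreservesHomology := inferInstance
  exact HomologicalComplex.quasiIso_map_of_preservesHomology f (tensorRight E)

theorem TensorQuasiIso.of_iso {f : X ⟶ Y} {E E' : ModuleCat.{u} B} (e : E ≅ E')
    (h : TensorQuasiIso f E) : TensorQuasiIso f E' := by
  unfold TensorQuasiIso at h ⊢
  let α := NatIso.mapHomologicalComplex ((tensoringRight (ModuleCat.{u} B)).mapIso e)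
    (ComplexShape.up ℤ)
  exact (quasiIso_iff_of_arrow_mk_iso _ _
    (Arrow.isoMk (α.app X) (α.app Y) (α.hom.naturality f).symm)).1 h

/-- The sequence of complexes obtained by tensoring a complex with a sequence of modules. -/
noncomputable def tensorShortComplex (X : CochainComplex (ModuleCat.{u} B) ℤ)
    (S : ShortComplex (ModuleCat.{u} B)) : ShortComplex (CochainComplex (ModuleCat.{u} B) ℤ) where
  X₁ := tensorComplex X S.X₁
  X₂ := tensorComplex X S.X₂
  X₃ := tensorComplex X S.X₃
  f := (NatTrans.mapHomologicalComplex ((tensoringRight (ModuleCat.{u} B)).map S.f) _).app X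
  g := (NatTrans.mapHomologicalComplex ((tensoringRight (ModuleCat.{u} B)).map S.g) _).app X
  zero := by
    ext i : 1
    change X.X i ◁ S.f ≫ X.X i ◁ S.g = 0
    rw [← MonoidalCategory.whiskerLeft_comp, S.zero, MonoidalPreadditive.whiskerLeft_zero]

/-- Right exactness of the tensor product gives everything except injectivity on the left, which is
exactly `hX`. -/
theorem tensorShortComplex_shortExact (X : CochainComplex (ModuleCat.{u} B) ℤ)
    {S : ShortComplex (ModuleCat.{u} B)} (hS : S.ShortExact)
    (hX : ∀ k, Function.Injective (S.f.hom.lTensor (X.X k))) :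
    (tensorShortComplex X S).ShortExact := by
  refine HomologicalComplex.shortExact_of_degreewise_shortExact _ fun k => ?_
  have hex := (ShortComplex.ShortExact.moduleCat_exact_iff_function_exact S).1 hS.exact
  have hsurj : Function.Surjective S.g.hom := (ModuleCat.epi_iff_surjective S.g).1 hS.epi_g
  refine ShortComplex.ShortExact.mk' ?_ ?_ ?_
  · rw [ShortComplex.ShortExact.moduleCat_exact_iff_function_exact]
    exact lTensor_exact (X.X k) hex hsurj
  · exact (ModuleCat.mono_iff_injective _).2 (hX k)
  · exact (ModuleCat.epi_iff_surjective _).2 (LinearMap.lTensor_surjective (X.X k) hsurj)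

/-- Five lemma for the long exact homology sequences of the two tensored short exact sequences. -/
theorem TensorQuasiIso.of_shortExact (f : X ⟶ Y) {S : ShortComplex (ModuleCat.{u} B)}
    (hS : S.ShortExact) (hX : ∀ k, Function.Injective (S.f.hom.lTensor (X.X k)))
    (hY : ∀ k, Function.Injective (S.f.hom.lTensor (Y.X k)))
    (h₁ : TensorQuasiIso f S.X₁) (h₂ : TensorQuasiIso f S.X₂) : TensorQuasiIso f S.X₃ := by
  let φ : tensorShortComplex X S ⟶ tensorShortComplex Y S :=
    { τ₁ := ((tensorRight S.X₁).mapHomologicalComplex (ComplexShape.up ℤ)).map f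
      τ₂ := ((tensorRight S.X₂).mapHomologicalComplex (ComplexShape.up ℤ)).map f
      τ₃ := ((tensorRight S.X₃).mapHomologicalComplex (ComplexShape.up ℤ)).map f
      comm₁₂ := NatTrans.mapHomologicalComplex_naturality _ _
      comm₂₃ := NatTrans.mapHomologicalComplex_naturality _ _ }
  exact HomologicalComplex.HomologySequence.quasiIso_τ₃ φ
    (tensorShortComplex_shortExact X hS hX) (tensorShortComplex_shortExact Y hS hY) h₁ h₂

end TensorQuasiIso

/-! ### Modules in which one can divide with remainder by a family of ring elements -/

section Division

variable {ι R : Type*} [CommRing R] (c : ι → R)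

/-- Operators `rem i` on `M` such that `rem i m` is a remainder of `m` modulo `c i`, where `m` is
called `i`-constant if `const i m` holds. -/
structure Division (M : Type*) [AddCommGroup M] [Module R M] where
  rem : ι → M →+ M
  quo : ι → M → M
  const : ι → M → Prop
  eq_add : ∀ i m, m = c i • quo i m + rem i m
  rem_smul_self : ∀ i m, rem i (c i • m) = 0
  rem_smul : ∀ i j m, i ≠ j → rem i (c j • m) = c j • rem i m
  const_rem_self : ∀ i m, const i (rem i m)
  const_rem : ∀ i j m, const i m → const i (rem j m)
  smul_injective : ∀ i (m : M), c i • m = 0 → m = 0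

variable {c} {M : Type*} [AddCommGroup M] [Module R M]

/-- Division with remainder in each coordinate. -/
def Division.pi (κ : Type*) (δ : Division c M) : Division c (κ → M) where
  rem i := (δ.rem i).compLeft κ
  quo i m := fun k => δ.quo i (m k)
  const i m := ∀ k, δ.const i (m k)
  eq_add i m := funext fun k => δ.eq_add i (m k)
  rem_smul_self i m := funext fun k => δ.rem_smul_self i (m k)
  rem_smul i j m h := funext fun k => δ.rem_smul i j (m k) h
  const_rem_self i m k := δ.const_rem_self i (m k)
  const_rem i j m h k := δ.const_rem i j (m k) (h k)
  smul_injective i m h := funext fun k => δ.smul_injective i (m k) (congrFun h k)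

theorem span_insert_smul_top [DecidableEq ι] (s : Finset ι) (b : ι) :
    (Ideal.span (c '' ↑(insert b s)) • ⊤ : Submodule R M) =
      Ideal.span {c b} • ⊤ ⊔ Ideal.span (c '' ↑s) • ⊤ := by
  rw [Finset.coe_insert, Set.image_insert_eq, Ideal.span_insert, Submodule.sup_smul]

/-- Take for `E` the composite of the operators `rem b`, `b ∈ s`. Since `rem b` commutes with
multiplication by every other `c j`, each factor still sees and kills the multiples of its own
element, and later factors preserve the constancy already achieved. -/
theorem Division.exists_rem (δ : Division c M) (s : Finset ι) :
    ∃ E : M →+ M, (∀ m, m - E m ∈ (Ideal.span (c '' ↑s) • ⊤ : Submodule R M)) ∧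
      (∀ i ∈ s, ∀ m, E (c i • m) = 0) ∧ (∀ i ∉ s, ∀ m, E (c i • m) = c i • E m) ∧
      ∀ i ∈ s, ∀ m, δ.const i (E m) := by
  classical
  induction s using Finset.induction_on with
  | empty => exact ⟨AddMonoidHom.id M, by simp⟩
  | insert b s hb ih =>
    obtain ⟨E, h₁, h₂, h₃, h₄⟩ := ih
    refine ⟨(δ.rem b).comp E, fun m => ?_, fun i hi m => ?_, fun i hi m => ?_, fun i hi m => ?_⟩
    · rw [span_insert_smul_top, AddMonoidHom.comp_apply]
      have e : m - δ.rem b (E m) = c b • δ.quo b (E m) + (m - E m) := by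
        conv_lhs => rw [← sub_add_sub_cancel m (E m)]
        conv_lhs => enter [2, 1]; rw [δ.eq_add b (E m)]
        abel
      rw [e]
      exact Submodule.add_mem_sup (Submodule.smul_mem_smul
        (Ideal.mem_span_singleton_self _) Submodule.mem_top) (h₁ m)
    · rw [AddMonoidHom.comp_apply]
      rcases Finset.mem_insert.1 hi with rfl | hi
      · rw [h₃ i hb, δ.rem_smul_self]
      · rw [h₂ i hi, map_zero]
    · rw [Finset.mem_insert, not_or] at hi
      rw [AddMonoidHom.comp_apply, AddMonoidHom.comp_apply, h₃ i hi.2,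
        δ.rem_smul b i _ (Ne.symm hi.1)]
    · rw [AddMonoidHom.comp_apply]
      rcases Finset.mem_insert.1 hi with rfl | hi
      · exact δ.const_rem_self i _
      · exact δ.const_rem i b _ (h₄ i hi m)

/-- `E` is only additive, so its kernel need not be a submodule. It is enough that the submodule in
question is, as an additive group, the sum of the `c i • M`. -/
theorem map_eq_zero_of_mem_span_smul {P : Type*} [AddCommGroup P] {s : Set ι} (E : M →+ P)
    (hE : ∀ i ∈ s, ∀ m, E (c i • m) = 0) {m : M}
    (hm : m ∈ (Ideal.span (c '' s) • ⊤ : Submodule R M)) : E m = 0 := by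
  rw [Submodule.span_smul_eq, Submodule.set_smul_eq_iSup] at hm
  refine Submodule.iSup_induction _ (motive := fun m => E m = 0) hm ?_ (map_zero E) ?_
  · intro a m hm
    by_cases ha : a ∈ c '' s
    · obtain ⟨i, hi, rfl⟩ := ha
      simp only [hi, Set.mem_image_of_mem, iSup_pos] at hm
      obtain ⟨m, -, rfl⟩ := hm
      exact hE i hi m
    · simp only [ha, iSup_neg, not_false_eq_true, Submodule.mem_bot] at hm
      rw [hm, map_zero]
  · intro x y hx hy
    rw [map_add, hx, hy, add_zero]

/-- The family `c` is a regular sequence on `M`, in any order. -/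
theorem Division.mem_of_smul_mem (δ : Division c M) (s : Finset ι) {i : ι} (hi : i ∉ s) {m : M}
    (hm : c i • m ∈ (Ideal.span (c '' ↑s) • ⊤ : Submodule R M)) :
    m ∈ (Ideal.span (c '' ↑s) • ⊤ : Submodule R M) := by
  -- From `0 = E (c i • m) = c i • E m` one gets `E m = 0`, and then `m = m - E m` lies in the
  -- submodule.
  obtain ⟨E, h₁, h₂, h₃, -⟩ := δ.exists_rem s
  have h := map_eq_zero_of_mem_span_smul E (fun i hi => h₂ i hi) hm
  rw [h₃ i hi] at h
  have := h₁ m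
  rwa [δ.smul_injective i _ h, sub_zero] at this

/-- If `ev` kills the multiples of the `c i` and is injective on the constants, then its kernel
consists of the combinations of the `c i`. -/
theorem Division.mem_of_map_eq_zero [Fintype ι] (δ : Division c M) {P : Type*} [AddCommGroup P]
    (ev : M →+ P) (hev : ∀ i m, ev (c i • m) = 0)
    (hc : ∀ m, (∀ i, δ.const i m) → ev m = 0 → m = 0) {m : M} (hm : ev m = 0) :
    m ∈ (Ideal.span (Set.range c) • ⊤ : Submodule R M) := by
  obtain ⟨E, h₁, -, -, h₄⟩ := δ.exists_rem Finset.univ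
  rw [Finset.coe_univ, Set.image_univ] at h₁
  have h : ev (m - E m) = 0 := map_eq_zero_of_mem_span_smul (s := Set.univ) (c := c) ev
    (fun i _ => hev i) (by rw [Set.image_univ]; exact h₁ m)
  rw [map_sub, hm, zero_sub, neg_eq_zero] at h
  have := h₁ m
  rwa [hc _ (fun i => h₄ i (Finset.mem_univ i) m) h, sub_zero] at this

end Division

/-! ### Base change -/

section BaseChange

open TensorProduct

/-- The basis identifies `S ⊗ M` with a finite power of `M`, and the map in `h` is then the
canonical map `S ⊗ M → N`. -/
theorem isBaseChange_of_basis {R S M N ι : Type*} [Fintype ι] [CommRing R] [CommRing S]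
    [Algebra R S]
    [AddCommGroup M] [Module R M] [AddCommGroup N] [Module R N] [Module S N] [IsScalarTower R S N]
    (b : Module.Basis ι R S) (f : M →ₗ[R] N)
    (h : Function.Bijective fun m : ι → M => ∑ i, b i • f (m i)) : IsBaseChange S f := by
  classical
  let e : (ι → M) ≃ₗ[R] S ⊗[R] M :=
    (Finsupp.linearEquivFunOnFinite R M ι).symm ≪≫ₗ (TensorProduct.equivFinsuppOfBasisLeft b).symm
  have key : ∀ m, TensorProduct.lift ((((Algebra.linearMap S <| Module.End S (M →ₗ[R] N)).flip
      f).restrictScalars R)) (e m) = ∑ i, b i • f (m i) := by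
    intro m
    simp [e, TensorProduct.equivFinsuppOfBasisLeft_symm_apply, Finsupp.sum_fintype]
  refine (Function.Bijective.of_comp_iff _ e.bijective).1 ?_
  convert h using 1
  funext m
  exact key m

/-- Here `S` is a quotient of `R`, so every tensor has the form `1 ⊗ m`, and `1 ⊗ m` dies as soon as
`m` lies in the kernel of `R → S` times `M`. -/
theorem isBaseChange_of_surjective {R S M N : Type*} [CommRing R] [CommRing S] [Algebra R S]
    [AddCommGroup M] [Module R M] [AddCommGroup N] [Module R N] [Module S N] [IsScalarTower R S N]
    (hS : Function.Surjective (algebraMap R S)) (f : M →ₗ[R] N) (hf : Function.Surjective f)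
    (hk : ∀ m, f m = 0 → m ∈ (RingHom.ker (algebraMap R S) • ⊤ : Submodule R M)) :
    IsBaseChange S f := by
  have key : ∀ x : S ⊗[R] M, ∃ m, x = 1 ⊗ₜ m := by
    intro x
    induction x using TensorProduct.induction_on with
    | zero => exact ⟨0, (tmul_zero _ _).symm⟩
    | tmul s m =>
      obtain ⟨r, rfl⟩ := hS s
      exact ⟨r • m, by rw [← smul_tmul, Algebra.smul_def, mul_one]⟩
    | add x y hx hy =>
      obtain ⟨m, rfl⟩ := hx
      obtain ⟨m', rfl⟩ := hy
      exact ⟨m + m', (tmul_add _ _ _).symm⟩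
  constructor
  · rw [injective_iff_map_eq_zero]
    intro x hx
    obtain ⟨m, rfl⟩ := key x
    have hm : f m = 0 := by simpa using hx
    refine Submodule.smul_induction_on (p := fun m => (1 : S) ⊗ₜ[R] m = 0) (hk m hm) ?_ ?_
    · intro r hr n _
      rw [← smul_tmul, Algebra.smul_def, (RingHom.mem_ker).1 hr, zero_mul, zero_tmul]
    · intro x y hx hy
      rw [tmul_add, hx, hy, add_zero]
  · intro y
    obtain ⟨m, rfl⟩ := hf y
    exact ⟨1 ⊗ₜ m, by simp⟩

end BaseChange

/-! ### Reduction modulo a regular sequence -/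

section Regular

open TensorProduct

variable {B : Type u} [CommRing B] {B' : Type u} [CommRing B'] [Algebra B B']

/-- The sequence `0 → B'/I → B'/I → B'/(I + (x)) → 0` of `B`-modules, the first map being the
multiplication by `x`. -/
noncomputable def mulShortComplex (B : Type u) [CommRing B] [Algebra B B'] (x : B')
    {I J : Ideal B'} (hIJ : J = Ideal.span {x} ⊔ I) : ShortComplex (ModuleCat.{u} B) where
  X₁ := ModuleCat.of B (B' ⧸ I)
  X₂ := ModuleCat.of B (B' ⧸ I)
  X₃ := ModuleCat.of B (B' ⧸ J)
  f := ModuleCat.ofHom ((LinearMap.lsmul B' (B' ⧸ I) x).restrictScalars B)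
  g := ModuleCat.ofHom (Ideal.Quotient.factorₐ B (hIJ ▸ le_sup_right : I ≤ J)).toLinearMap
  zero := by
    ext y
    obtain ⟨y, rfl⟩ := Ideal.Quotient.mk_surjective y
    change Ideal.Quotient.mk J (x * y) = 0
    rw [Ideal.Quotient.eq_zero_iff_mem, hIJ]
    exact Ideal.mem_sup_left (Ideal.mul_mem_right _ _ (Ideal.mem_span_singleton_self x))

/-- `hx` says that `x` is a nonzerodivisor on `B' ⧸ I`, which gives injectivity; the rest holds for
any `x`. -/
theorem mulShortComplex_shortExact (x : B') {I J : Ideal B'} (hIJ : J = Ideal.span {x} ⊔ I)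
    (hx : ∀ y, x * y ∈ I → y ∈ I) : (mulShortComplex B x hIJ).ShortExact := by
  refine ShortComplex.ShortExact.mk' ?_ ?_ ?_
  · rw [ShortComplex.ShortExact.moduleCat_exact_iff_function_exact]
    intro y
    obtain ⟨y, rfl⟩ := Ideal.Quotient.mk_surjective y
    change Ideal.Quotient.mk J y = 0 ↔ ∃ z, x • z = Ideal.Quotient.mk I y
    rw [Ideal.Quotient.eq_zero_iff_mem, hIJ]
    constructor
    · intro h
      obtain ⟨z, hz, i, hi, rfl⟩ := Submodule.mem_sup.1 h
      obtain ⟨z, rfl⟩ := Ideal.mem_span_singleton'.1 hz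
      refine ⟨Ideal.Quotient.mk I z, ?_⟩
      change Ideal.Quotient.mk I (x * z) = _
      rw [Ideal.Quotient.mk_eq_mk_iff_sub_mem]
      convert I.neg_mem hi using 1
      ring
    · rintro ⟨z, hz⟩
      obtain ⟨z, rfl⟩ := Ideal.Quotient.mk_surjective z
      change Ideal.Quotient.mk I (x * z) = _ at hz
      rw [Ideal.Quotient.mk_eq_mk_iff_sub_mem] at hz
      rw [← sub_sub_cancel (x * z) y]
      exact Ideal.sub_mem _ (Ideal.mem_sup_left
        (Ideal.mul_mem_right _ _ (Ideal.mem_span_singleton_self x))) (Ideal.mem_sup_right hz)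
  · refine (ModuleCat.mono_iff_injective _).2 ((injective_iff_map_eq_zero _).2 fun y hy => ?_)
    obtain ⟨y, rfl⟩ := Ideal.Quotient.mk_surjective y
    change Ideal.Quotient.mk I (x * y) = 0 at hy
    rw [Ideal.Quotient.eq_zero_iff_mem] at hy
    exact Ideal.Quotient.eq_zero_iff_mem.2 (hx y hy)
  · exact (ModuleCat.epi_iff_surjective _).2 (Ideal.Quotient.factor_surjective (hIJ ▸ le_sup_right))

/-- Base change identifies `M ⊗[B] (B' ⧸ I)` with `M' / I M'`, on which the map becomes
multiplication by `x`. Regularity of `x` on the quotient of `M'` thus replaces flatness of `M`. -/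
theorem lTensor_lsmul_injective {M M' : Type u} [AddCommGroup M] [Module B M]
    [AddCommGroup M'] [Module B M'] [Module B' M'] [IsScalarTower B B' M'] {f : M →ₗ[B] M'}
    (hf : IsBaseChange B' f) (x : B') (I : Ideal B')
    (hx : ∀ m : M', x • m ∈ (I • ⊤ : Submodule B' M') → m ∈ (I • ⊤ : Submodule B' M')) :
    Function.Injective
      (((LinearMap.lsmul B' (B' ⧸ I) x).restrictScalars B).lTensor M) := by
  rw [LinearMap.lTensor_inj_iff_rTensor_inj]
  have e := (hf.tensorEquiv (B' ⧸ I)).symm ≪≫ₗ quotTensorEquivQuotSMul M' I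
  have h : ∀ z, ((LinearMap.lsmul B' (B' ⧸ I) x).restrictScalars B).rTensor M z = x • z := by
    intro z
    induction z using TensorProduct.induction_on with
    | zero => simp
    | tmul s m => rfl
    | add y z hy hz => rw [map_add, hy, hz, smul_add]
  rw [injective_iff_map_eq_zero]
  intro z hz
  rw [h] at hz
  apply e.injective
  have hz' : x • e z = 0 := by rw [← map_smul, hz, map_zero]
  obtain ⟨m, hm⟩ := Submodule.Quotient.mk_surjective _ (e z)
  rw [← hm, ← Submodule.Quotient.mk_smul, Submodule.Quotient.mk_eq_zero] at hz'
  rw [← hm, map_zero, Submodule.Quotient.mk_eq_zero]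
  exact hx m hz'

theorem lTensor_injective_of_equiv {R M N P Q : Type*} [CommRing R] [AddCommGroup M]
    [AddCommGroup N] [AddCommGroup P] [AddCommGroup Q] [Module R M] [Module R N] [Module R P]
    [Module R Q] (e : M ≃ₗ[R] N) (u : P →ₗ[R] Q) (h : Function.Injective (u.lTensor N)) :
    Function.Injective (u.lTensor M) := by
  refine Function.Injective.of_comp (f := e.toLinearMap.rTensor Q) ?_
  rw [← LinearMap.coe_comp, LinearMap.rTensor_comp_lTensor, ← LinearMap.lTensor_comp_rTensor,
    LinearMap.coe_comp]
  exact h.comp (LinearEquiv.rTensor P e).injective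

/-- Induction on `s`, killing one `c b` at a time. Tensoring the multiplication sequence stays exact
for two different reasons: the terms of `X` are flat, while those of `Y` are finite powers of `M`,
where `δ'` gives regularity after base change to `M'`. -/
theorem TensorQuasiIso.quotient_span [Module.Flat B B'] {X Y : CochainComplex (ModuleCat.{u} B) ℤ}
    (f : X ⟶ Y) [QuasiIso f] [∀ k, Module.Flat B (X.X k)] {M M' : Type u} [AddCommGroup M]
    [Module B M] [AddCommGroup M'] [Module B M'] [Module B' M'] [IsScalarTower B B' M']
    {φ : M →ₗ[B] M'} (hφ : IsBaseChange B' φ)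
    (hY : ∀ k, ∃ κ : Type, Finite κ ∧ Nonempty (Y.X k ≃ₗ[B] (κ → M)))
    {ι : Type*} {c : ι → B'} (δ : Division c B') (δ' : Division c M') (s : Finset ι) :
    TensorQuasiIso f (ModuleCat.of B (B' ⧸ Ideal.span (c '' ↑s))) := by
  classical
  induction s using Finset.induction_on with
  | empty =>
    have : Ideal.span (c '' ↑(∅ : Finset ι)) = ⊥ := by simp
    rw [this]
    have : Module.Flat B (B' ⧸ (⊥ : Ideal B')) :=
      Module.Flat.of_linearEquiv (AlgEquiv.quotientBot B B').toLinearEquiv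
    exact .of_flat f _
  | insert b s hb ih =>
    have hJ : Ideal.span (c '' ↑(insert b s)) = Ideal.span {c b} ⊔ Ideal.span (c '' ↑s) := by
      rw [Finset.coe_insert, Set.image_insert_eq, Ideal.span_insert]
    -- Regularity on `B'` itself makes the multiplication sequence exact before tensoring.
    have hreg : ∀ y, c b * y ∈ Ideal.span (c '' ↑s) → y ∈ Ideal.span (c '' ↑s) := by
      intro y hy
      have := δ.mem_of_smul_mem s hb (m := y)
      simp only [smul_eq_mul, Ideal.mul_top] at this
      exact this hy
    have hS := mulShortComplex_shortExact (B := B) (c b) hJ hreg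
    have ih₁ : TensorQuasiIso f (mulShortComplex B (c b) hJ).X₁ := ih
    have ih₂ : TensorQuasiIso f (mulShortComplex B (c b) hJ).X₂ := ih
    suffices TensorQuasiIso f (mulShortComplex B (c b) hJ).X₃ from this
    refine TensorQuasiIso.of_shortExact f hS (fun k => ?_) (fun k => ?_) ih₁ ih₂
    · exact Module.Flat.lTensor_preserves_injective_linearMap _
        ((ModuleCat.mono_iff_injective _).1 hS.mono_f)
    · obtain ⟨κ, _, ⟨e⟩⟩ := hY k
      have hi := lTensor_lsmul_injective (hφ.finitePow κ) (c b) (Ideal.span (c '' ↑s))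
        fun m => (δ'.pi κ).mem_of_smul_mem s hb
      exact lTensor_injective_of_equiv e _ hi

end Regular

/-! ### Division of power series by `X_j - a` -/

section SeriesDivision

variable {σ F : Type*} [NormedField F]

/-- The coefficients of `f` are bounded by `C` in the norm of radius `r`. -/
def CoeffBound (r C : ℝ) (f : MvPowerSeries σ F) : Prop :=
  ∀ v : σ →₀ ℕ, ‖MvPowerSeries.coeff v f‖ * r ^ v.degree ≤ C

theorem CoeffBound.norm_le {r C : ℝ} (hr : 1 < r) {f : MvPowerSeries σ F} (hf : CoeffBound r C f)
    (v : σ →₀ ℕ) : ‖MvPowerSeries.coeff v f‖ ≤ C * r⁻¹ ^ v.degree := by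
  rw [inv_pow, ← div_eq_mul_inv, le_div_iff₀ (pow_pos (one_pos.trans hr) _)]
  exact hf v

theorem CoeffBound.nonneg {r C : ℝ} {f : MvPowerSeries σ F} (hf : CoeffBound r C f) : 0 ≤ C := by
  refine le_trans ?_ (hf 0)
  simp

/-- The ultrametric bound on finite partial sums passes to the limit; a divergent sum is 0 by
convention, so summability need not be assumed. -/
theorem norm_tsum_le_of_forall_le [IsUltrametricDist F] {ι : Type*} {f : ι → F} {C : ℝ}
    (hC : 0 ≤ C) (h : ∀ i, ‖f i‖ ≤ C) : ‖∑' i, f i‖ ≤ C := by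
  by_cases hs : Summable f
  · exact le_of_tendsto hs.hasSum.norm (Filter.Eventually.of_forall fun s =>
      IsUltrametricDist.norm_sum_le_of_forall_le_of_nonneg hC fun i _ => h i)
  · rwa [tsum_eq_zero_of_not_summable hs, norm_zero]

/-- The series with coefficients `∑ k, a ^ k f_{v + k e_j}`. -/
noncomputable def tailSeries (a : F) (j : σ) (f : MvPowerSeries σ F) : MvPowerSeries σ F :=
  fun v => ∑' k : ℕ, a ^ k * MvPowerSeries.coeff (v + Finsupp.single j k) f

open Classical in
/-- The remainder of `f` modulo `X_j - a`. -/
noncomputable def remSeries (a : F) (j : σ) (f : MvPowerSeries σ F) : MvPowerSeries σ F :=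
  fun v => if v j = 0 then MvPowerSeries.coeff v (tailSeries a j f) else 0

/-- The quotient of `f` by `X_j - a`. -/
noncomputable def quoSeries (a : F) (j : σ) (f : MvPowerSeries σ F) : MvPowerSeries σ F :=
  fun v => MvPowerSeries.coeff (v + Finsupp.single j 1) (tailSeries a j f)

theorem coeff_tailSeries (a : F) (j : σ) (f : MvPowerSeries σ F) (v : σ →₀ ℕ) :
    MvPowerSeries.coeff v (tailSeries a j f) =
      ∑' k : ℕ, a ^ k * MvPowerSeries.coeff (v + Finsupp.single j k) f := rfl

open Classical in
theorem coeff_remSeries (a : F) (j : σ) (f : MvPowerSeries σ F) (v : σ →₀ ℕ) :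
    MvPowerSeries.coeff v (remSeries a j f) =
      if v j = 0 then MvPowerSeries.coeff v (tailSeries a j f) else 0 := rfl

theorem coeff_quoSeries (a : F) (j : σ) (f : MvPowerSeries σ F) (v : σ →₀ ℕ) :
    MvPowerSeries.coeff v (quoSeries a j f) =
      MvPowerSeries.coeff (v + Finsupp.single j 1) (tailSeries a j f) := rfl

theorem norm_pow_mul_coeff_le {a : F} (ha : ‖a‖ ≤ 1) (j : σ) {r C : ℝ} (hr : 1 < r)
    {f : MvPowerSeries σ F} (hf : CoeffBound r C f) (v : σ →₀ ℕ) (k : ℕ) :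
    ‖a ^ k * MvPowerSeries.coeff (v + Finsupp.single j k) f‖ ≤
      C * r⁻¹ ^ v.degree * r⁻¹ ^ k := by
  have h1 : ‖a ^ k‖ ≤ 1 := by rw [norm_pow]; exact pow_le_one₀ (norm_nonneg _) ha
  rw [norm_mul]
  refine (mul_le_of_le_one_left (norm_nonneg _) h1).trans ((hf.norm_le hr _).trans_eq ?_)
  rw [map_add, Finsupp.degree_single, pow_add, mul_assoc]

/-- Both `r` and `C` are preserved: `‖a‖ ≤ 1`, the shift to `v + k e_j` gains the factor `r⁻¹ ^ k ≤
1`, and the norm of the sum is at most the largest bound. The unchanged `C` is what later keeps the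
decay in `t`. -/
theorem coeffBound_tailSeries [IsUltrametricDist F] {a : F} (ha : ‖a‖ ≤ 1) (j : σ) {r C : ℝ}
    (hr : 1 < r) {f : MvPowerSeries σ F} (hf : CoeffBound r C f) :
    CoeffBound r C (tailSeries a j f) := by
  have hr0 : 0 < r := one_pos.trans hr
  have hC := hf.nonneg
  intro v
  rw [← le_div_iff₀ (pow_pos hr0 _), div_eq_mul_inv, ← inv_pow, coeff_tailSeries]
  refine norm_tsum_le_of_forall_le (by positivity) fun k => ?_
  refine (norm_pow_mul_coeff_le ha j hr hf v k).trans ?_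
  exact mul_le_of_le_one_right (by positivity)
    (pow_le_one₀ (by positivity) (inv_le_one_of_one_le₀ hr.le))

theorem coeffBound_remSeries [IsUltrametricDist F] {a : F} (ha : ‖a‖ ≤ 1) (j : σ) {r C : ℝ}
    (hr : 1 < r) {f : MvPowerSeries σ F} (hf : CoeffBound r C f) :
    CoeffBound r C (remSeries a j f) := by
  intro v
  rw [coeff_remSeries]
  split_ifs
  · exact coeffBound_tailSeries ha j hr hf v
  · simpa using hf.nonneg

theorem coeffBound_quoSeries [IsUltrametricDist F] {a : F} (ha : ‖a‖ ≤ 1) (j : σ) {r C : ℝ}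
    (hr : 1 < r) {f : MvPowerSeries σ F} (hf : CoeffBound r C f) :
    CoeffBound r C (quoSeries a j f) := by
  intro v
  refine le_trans ?_ (coeffBound_tailSeries ha j hr hf (v + Finsupp.single j 1))
  rw [coeff_quoSeries]
  gcongr
  · exact hr.le
  · rw [map_add]
    exact Nat.le_add_right _ _

theorem summable_tailSeries [CompleteSpace F] {a : F} (ha : ‖a‖ ≤ 1) (j : σ) {r C : ℝ}
    (hr : 1 < r) {f : MvPowerSeries σ F} (hf : CoeffBound r C f) (v : σ →₀ ℕ) :
    Summable fun k : ℕ => a ^ k * MvPowerSeries.coeff (v + Finsupp.single j k) f :=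
  Summable.of_norm_bounded ((summable_geometric_of_lt_one (inv_nonneg.2 (one_pos.trans hr).le)
    (inv_lt_one_of_one_lt₀ hr)).mul_left _) (norm_pow_mul_coeff_le ha j hr hf v)

/-- Splitting off the term `k = 0` gives the recursion T_v = f_v + a T_{v + e_j}. This is the
coefficient form of division by X_j - a, and all the division identities below come from it. -/
theorem coeff_tailSeries_eq [CompleteSpace F] {a : F} (ha : ‖a‖ ≤ 1) (j : σ) {r C : ℝ}
    (hr : 1 < r) {f : MvPowerSeries σ F} (hf : CoeffBound r C f) (v : σ →₀ ℕ) :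
    MvPowerSeries.coeff v (tailSeries a j f) = MvPowerSeries.coeff v f +
      a * MvPowerSeries.coeff (v + Finsupp.single j 1) (tailSeries a j f) := by
  rw [coeff_tailSeries, (summable_tailSeries ha j hr hf v).tsum_eq_zero_add, coeff_tailSeries,
    ← tsum_mul_left]
  congr 1
  · simp
  · refine tsum_congr fun k => ?_
    rw [pow_succ', mul_assoc, add_comm k, Finsupp.single_add, add_assoc]

theorem tailSeries_add [CompleteSpace F] {a : F} (ha : ‖a‖ ≤ 1) (j : σ) {r C r' C' : ℝ}
    (hr : 1 < r) {f : MvPowerSeries σ F} (hf : CoeffBound r C f) (hr' : 1 < r')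
    {g : MvPowerSeries σ F} (hg : CoeffBound r' C' g) :
    tailSeries a j (f + g) = tailSeries a j f + tailSeries a j g := by
  ext v
  rw [map_add, coeff_tailSeries, coeff_tailSeries, coeff_tailSeries,
    ← (summable_tailSeries ha j hr hf v).tsum_add (summable_tailSeries ha j hr' hg v)]
  exact tsum_congr fun k => by rw [map_add, mul_add]

theorem tailSeries_C_mul (a b : F) (j : σ) (f : MvPowerSeries σ F) :
    tailSeries a j (MvPowerSeries.C b * f) = MvPowerSeries.C b * tailSeries a j f := by
  ext v
  rw [MvPowerSeries.coeff_C_mul, coeff_tailSeries, coeff_tailSeries, ← tsum_mul_left]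
  refine tsum_congr fun k => ?_
  rw [MvPowerSeries.coeff_C_mul]
  ring

open Classical in
theorem coeff_X_mul (i : σ) (f : MvPowerSeries σ F) (v : σ →₀ ℕ) :
    MvPowerSeries.coeff v (MvPowerSeries.X i * f) =
      if v i = 0 then 0 else MvPowerSeries.coeff (v - Finsupp.single i 1) f := by
  rw [MvPowerSeries.X, MvPowerSeries.coeff_monomial_mul, one_mul]
  simp only [Finsupp.single_le_iff, Nat.one_le_iff_ne_zero, ite_not]

theorem coeff_add_single_X_mul (i : σ) (f : MvPowerSeries σ F) (v : σ →₀ ℕ) :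
    MvPowerSeries.coeff (v + Finsupp.single i 1) (MvPowerSeries.X i * f) =
      MvPowerSeries.coeff v f := by
  rw [add_comm, MvPowerSeries.X, MvPowerSeries.coeff_add_monomial_mul, one_mul]

theorem coeffBound_X_mul (i : σ) {r C : ℝ} {f : MvPowerSeries σ F} (hf : CoeffBound r C f)
    (hr : 1 < r) : CoeffBound r (C * r) (MvPowerSeries.X i * f) := by
  classical
  have hr0 : 0 < r := one_pos.trans hr
  intro v
  rw [coeff_X_mul]
  split_ifs with h
  · have := hf.nonneg
    rw [norm_zero, zero_mul]
    positivity
  · obtain ⟨u, rfl⟩ : ∃ u, v = u + Finsupp.single i 1 :=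
      ⟨v - Finsupp.single i 1, (tsub_add_cancel_of_le (by
        rw [Finsupp.single_le_iff]; exact Nat.one_le_iff_ne_zero.2 h)).symm⟩
    rw [add_tsub_cancel_right, map_add, Finsupp.degree_single, pow_add, pow_one, ← mul_assoc]
    exact mul_le_mul_of_nonneg_right (hf u) hr0.le

theorem coeffBound_C_mul (b : F) {r C : ℝ} {f : MvPowerSeries σ F} (hf : CoeffBound r C f) :
    CoeffBound r (‖b‖ * C) (MvPowerSeries.C b * f) := by
  intro v
  rw [MvPowerSeries.coeff_C_mul, norm_mul, mul_assoc]
  exact mul_le_mul_of_nonneg_left (hf v) (norm_nonneg _)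

/-- As `X_j f` has no coefficient at `v`, the recursion leaves only `a` times its tail at `v + e_j`,
and that tail is the one of `f` at `v`. -/
theorem coeff_tailSeries_X_mul_self [CompleteSpace F] {a : F} (ha : ‖a‖ ≤ 1) (j : σ) {r C : ℝ}
    (hr : 1 < r) {f : MvPowerSeries σ F} (hf : CoeffBound r C f) {v : σ →₀ ℕ} (hv : v j = 0) :
    MvPowerSeries.coeff v (tailSeries a j (MvPowerSeries.X j * f)) =
      a * MvPowerSeries.coeff v (tailSeries a j f) := by
  classical
  rw [coeff_tailSeries_eq ha j hr (coeffBound_X_mul j hf hr), coeff_X_mul, if_pos hv, zero_add]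
  congr 1
  rw [coeff_tailSeries, coeff_tailSeries]
  exact tsum_congr fun k => by rw [add_right_comm, coeff_add_single_X_mul]

/-- The sum runs in direction `i` and leaves the exponent of `X_j` untouched. -/
theorem tailSeries_X_mul (a : F) {i j : σ} (hij : i ≠ j) (f : MvPowerSeries σ F) :
    tailSeries a i (MvPowerSeries.X j * f) = MvPowerSeries.X j * tailSeries a i f := by
  classical
  ext v
  rw [coeff_X_mul, coeff_tailSeries]
  have h : ∀ k, (v + Finsupp.single i k : σ →₀ ℕ) j = v j := fun k => by simp [hij.symm]
  simp only [coeff_X_mul, h]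
  split_ifs with hv
  · simp
  · rw [coeff_tailSeries]
    refine tsum_congr fun k => ?_
    rw [tsub_add_eq_add_tsub]
    rw [Finsupp.single_le_iff]
    exact Nat.one_le_iff_ne_zero.2 hv

/-- The quotient has coefficients T_{v + e_j}. Multiplying it by X_j - a gives T_v - a T_{v + e_j} =
f_v when v_j > 0; when v_j = 0 the term T_v is missing, and the remainder supplies it. -/
theorem eq_quoSeries_add_remSeries [CompleteSpace F] {a : F} (ha : ‖a‖ ≤ 1) (j : σ) {r C : ℝ}
    (hr : 1 < r) {f : MvPowerSeries σ F} (hf : CoeffBound r C f) :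
    f = (MvPowerSeries.X j - MvPowerSeries.C a) * quoSeries a j f + remSeries a j f := by
  classical
  ext v
  have h := coeff_tailSeries_eq ha j hr hf v
  rw [map_add, sub_mul, map_sub, coeff_X_mul, MvPowerSeries.coeff_C_mul, coeff_remSeries]
  split_ifs with hv
  · rw [h, coeff_quoSeries]
    ring
  · rw [coeff_quoSeries, coeff_quoSeries, tsub_add_cancel_of_le, h]
    · ring
    · rw [Finsupp.single_le_iff]
      exact Nat.one_le_iff_ne_zero.2 hv

theorem remSeries_add [CompleteSpace F] {a : F} (ha : ‖a‖ ≤ 1) (j : σ) {r C r' C' : ℝ}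
    (hr : 1 < r) {f : MvPowerSeries σ F} (hf : CoeffBound r C f) (hr' : 1 < r')
    {g : MvPowerSeries σ F} (hg : CoeffBound r' C' g) :
    remSeries a j (f + g) = remSeries a j f + remSeries a j g := by
  classical
  ext v
  rw [map_add, coeff_remSeries, coeff_remSeries, coeff_remSeries, tailSeries_add ha j hr hf hr' hg]
  split_ifs
  · rw [map_add]
  · rw [add_zero]

theorem tailSeries_X_sub_C_mul [CompleteSpace F] {a : F} (ha : ‖a‖ ≤ 1) (i j : σ) (b : F)
    {r C : ℝ} (hr : 1 < r) {f : MvPowerSeries σ F} (hf : CoeffBound r C f) :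
    tailSeries a i ((MvPowerSeries.X j - MvPowerSeries.C b) * f) =
      tailSeries a i (MvPowerSeries.X j * f) - MvPowerSeries.C b * tailSeries a i f := by
  rw [sub_mul, sub_eq_add_neg, sub_eq_add_neg, ← neg_mul, ← neg_mul, ← map_neg,
    tailSeries_add ha i hr (coeffBound_X_mul j hf hr) hr (coeffBound_C_mul _ hf), tailSeries_C_mul]

theorem remSeries_mul_self [CompleteSpace F] {a : F} (ha : ‖a‖ ≤ 1) (j : σ) {r C : ℝ}
    (hr : 1 < r) {f : MvPowerSeries σ F} (hf : CoeffBound r C f) :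
    remSeries a j ((MvPowerSeries.X j - MvPowerSeries.C a) * f) = 0 := by
  classical
  ext v
  rw [coeff_remSeries, tailSeries_X_sub_C_mul ha j j a hr hf, map_sub, MvPowerSeries.coeff_C_mul,
    map_zero]
  split_ifs with hv
  · rw [coeff_tailSeries_X_mul_self ha j hr hf hv, sub_self]
  · rfl

theorem remSeries_mul [CompleteSpace F] {a : F} (ha : ‖a‖ ≤ 1) {i j : σ} (hij : i ≠ j) (b : F)
    {r C : ℝ} (hr : 1 < r) {f : MvPowerSeries σ F} (hf : CoeffBound r C f) :
    remSeries a i ((MvPowerSeries.X j - MvPowerSeries.C b) * f) =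
      (MvPowerSeries.X j - MvPowerSeries.C b) * remSeries a i f := by
  classical
  ext v
  rw [coeff_remSeries, tailSeries_X_sub_C_mul ha i j b hr hf, tailSeries_X_mul a hij, sub_mul,
    map_sub, map_sub, MvPowerSeries.coeff_C_mul, MvPowerSeries.coeff_C_mul, coeff_X_mul,
    coeff_X_mul, coeff_remSeries, coeff_remSeries]
  have h : (v - Finsupp.single j 1 : σ →₀ ℕ) i = v i := by simp [hij]
  rw [h]
  split_ifs <;> simp

theorem X_sub_C_ne_zero (j : σ) (a : F) :
    (MvPowerSeries.X j - MvPowerSeries.C a : MvPowerSeries σ F) ≠ 0 := by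
  classical
  intro h
  have := congrArg (MvPowerSeries.coeff (Finsupp.single j 1)) h
  rw [map_sub, MvPowerSeries.coeff_index_single_self_X, MvPowerSeries.coeff_C_of_ne_zero,
    map_zero] at this
  · simp at this
  · simp

end SeriesDivision

/-! ### Division by X_j - a_j in the overconvergent ring and in L† -/

section DaggerDivision

variable (p : ℕ) [Fact p.Prime] {F : Type u} [NormedField F] [NormedAlgebra ℚ_[p] F]
  {n N : ℕ}

/-- The element `X_j - a_j` of the ring of overconvergent series. -/
noncomputable def Dagger.XSub (a : Fin N → F) (j : Fin N) : Dagger p F N :=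
  Dagger.X p F j - algebraMap F (Dagger p F N) (a j)

/-- Division with remainder by the `X_j - a_j` in the ring of overconvergent series. -/
noncomputable def Dagger.division [CompleteSpace F] (a : Fin N → F) (ha : ∀ j, ‖a j‖ ≤ 1) :
    Division (Dagger.XSub p a) (Dagger p F N) where
  rem j :=
    { toFun := fun f => ⟨remSeries (a j) j f.1, by
        have := isUltrametricDist_of_padic p F
        obtain ⟨f, r, hr, C, h⟩ := f
        exact ⟨r, hr, C, coeffBound_remSeries (ha j) j hr h⟩⟩
      map_zero' := by
        refine Subtype.ext (MvPowerSeries.ext fun v => ?_)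
        change MvPowerSeries.coeff v (remSeries (a j) j 0) = 0
        simp [coeff_remSeries, coeff_tailSeries]
      map_add' := by
        rintro ⟨f, r, hr, C, h⟩ ⟨g, r', hr', C', h'⟩
        exact Subtype.ext (remSeries_add (ha j) j hr h hr' h') }
  quo j f := ⟨quoSeries (a j) j f.1, by
    have := isUltrametricDist_of_padic p F
    obtain ⟨f, r, hr, C, h⟩ := f
    exact ⟨r, hr, C, coeffBound_quoSeries (ha j) j hr h⟩⟩
  -- That is, `x_i` does not occur in `f`. A series satisfying this for all `i` is a scalar, on
  -- which evaluation is injective.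
  const i f := ∀ v : Fin N →₀ ℕ, v i ≠ 0 → MvPowerSeries.coeff v f.1 = 0
  eq_add := by
    rintro j ⟨f, r, hr, C, h⟩
    exact Subtype.ext (eq_quoSeries_add_remSeries (ha j) j hr h)
  rem_smul_self := by
    rintro j ⟨f, r, hr, C, h⟩
    exact Subtype.ext (remSeries_mul_self (ha j) j hr h)
  rem_smul := by
    rintro i j ⟨f, r, hr, C, h⟩ hij
    exact Subtype.ext (remSeries_mul (ha i) hij (a j) hr h)
  const_rem_self i f v hv := (coeff_remSeries _ _ _ _).trans (if_neg hv)
  const_rem i j f hf v hv := by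
    change MvPowerSeries.coeff v (remSeries (a j) j f.1) = 0
    rw [coeff_remSeries, coeff_tailSeries]
    split_ifs
    · refine (tsum_congr fun k => ?_).trans tsum_zero
      rw [hf, mul_zero]
      rw [Finsupp.add_apply]
      omega
    · rfl
  -- Power series over a field form a domain.
  smul_injective i f hf := by
    have h : (MvPowerSeries.X i - MvPowerSeries.C (a i)) * f.1 = 0 := congrArg Subtype.val hf
    exact Subtype.ext ((mul_eq_zero.1 h).resolve_left (X_sub_C_ne_zero i (a i)))

variable {p} {A : Matrix (Fin n) (Fin N) ℤ}

/-- The decay in `t` is moved into the constant, with one `r` for all `w`. An operator on power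
series that keeps `r` and scales the constant by a fixed factor can then be applied coefficientwise
in `t`. Outside the cone the coefficients are zero. -/
theorem LDagger_exists_coeffBound (g : LDagger p F A) :
    ∃ r : ℝ, 1 < r ∧ ∃ s : ℝ, 1 < s ∧ ∃ C : ℝ, ∀ w : Fin n → ℤ,
      CoeffBound r (C / s ^ weight A (toReal w)) (g.1 w) := by
  obtain ⟨g, hg0, r, hr, s, hs, C, h⟩ := g
  have hs0 : 0 < s := one_pos.trans hs
  have hC : 0 ≤ C := le_trans (by positivity) (h 0 0 (by rw [toReal_zero]; exact zero_mem _))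
  refine ⟨r, hr, s, hs, C, fun w v => ?_⟩
  by_cases hw : toReal w ∈ newtonCone A
  · rw [le_div_iff₀ (by positivity)]
    exact h v w hw
  · simp only [hg0 w hw, map_zero, norm_zero, zero_mul]
    positivity

theorem mem_LDagger_of_coeffBound {g : (Fin n → ℤ) → MvPowerSeries (Fin N) F}
    (h0 : ∀ w, toReal w ∉ newtonCone A → g w = 0) {r s C : ℝ} (hr : 1 < r) (hs : 1 < s)
    (h : ∀ w, CoeffBound r (C / s ^ weight A (toReal w)) (g w)) : g ∈ LDagger p F A := by
  refine ⟨h0, r, hr, s, hs, C, fun v w _ => ?_⟩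
  rw [← le_div_iff₀ (Real.rpow_pos_of_pos (one_pos.trans hs) _)]
  exact h w v

/-- The coefficient of `t^w` of a series in `L†`. -/
noncomputable def LDagger.coeff (w : Fin n → ℤ) : LDagger p F A →ₗ[Dagger p F N] Dagger p F N where
  toFun g := ⟨g.1 w, by
    obtain ⟨r, hr, s, hs, C, h⟩ := LDagger_exists_coeffBound g
    exact ⟨r, hr, _, h w⟩⟩
  map_add' _ _ := rfl
  map_smul' _ _ := rfl

theorem LDagger.ext_coeff {g h : LDagger p F A}
    (H : ∀ w, LDagger.coeff w g = LDagger.coeff w h) : g = h :=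
  Subtype.ext (funext fun w => congrArg Subtype.val (H w))

/-- A map on overconvergent series which preserves bounds, applied to the coefficients of a
series in `L†`. -/
noncomputable def LDagger.mapCoeff {F' : Type u} [NormedField F'] [NormedAlgebra ℚ_[p] F']
    (T : Dagger p F N → Dagger p F' N) (h0 : T 0 = 0) (c : ℝ)
    (hT : ∀ r C : ℝ, 1 < r → ∀ f : Dagger p F N, CoeffBound r C f.1 → CoeffBound r (c * C) (T f).1)
    (g : LDagger p F A) : LDagger p F' A :=
  ⟨fun w => (T (LDagger.coeff w g)).1, by
    obtain ⟨r, hr, s, hs, C, h⟩ := LDagger_exists_coeffBound g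
    refine mem_LDagger_of_coeffBound (C := c * C) (fun w hw => ?_) hr hs fun w => ?_
    · have : LDagger.coeff w g = 0 := Subtype.ext (g.2.1 w hw)
      rw [this, h0]
      rfl
    · rw [mul_div_assoc]
      exact hT r _ hr _ (h w)⟩

theorem LDagger.coeff_mapCoeff {F' : Type u} [NormedField F'] [NormedAlgebra ℚ_[p] F']
    (T : Dagger p F N → Dagger p F' N) (h0 : T 0 = 0) (c : ℝ)
    (hT : ∀ r C : ℝ, 1 < r → ∀ f : Dagger p F N, CoeffBound r C f.1 → CoeffBound r (c * C) (T f).1)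
    (g : LDagger p F A) (w : Fin n → ℤ) :
    LDagger.coeff w (LDagger.mapCoeff T h0 c hT g) = T (LDagger.coeff w g) := rfl

variable (A) in
/-- Division with remainder by the `X_j - a_j` in `L†`. -/
noncomputable def LDagger.division [CompleteSpace F] (a : Fin N → F) (ha : ∀ j, ‖a j‖ ≤ 1) :
    Division (Dagger.XSub p a) (LDagger p F A) where
  rem j :=
    -- The factor is 1 because remainders satisfy the same bounds as the series.
    { toFun := LDagger.mapCoeff ((Dagger.division p a ha).rem j) (map_zero _) 1
        fun r C hr f hf => by
          have := isUltrametricDist_of_padic p F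
          rw [one_mul]
          exact coeffBound_remSeries (ha j) j hr hf
      map_zero' := LDagger.ext_coeff fun w => by
        rw [LDagger.coeff_mapCoeff, map_zero, map_zero]
      map_add' := fun f g => LDagger.ext_coeff fun w => by
        rw [map_add]
        exact (congrArg ((Dagger.division p a ha).rem j) (map_add (LDagger.coeff w) f g)).trans
          (map_add _ _ _) }
  quo j := LDagger.mapCoeff ((Dagger.division p a ha).quo j)
    (Subtype.ext (MvPowerSeries.ext fun v => by
      change MvPowerSeries.coeff v (quoSeries (a j) j 0) = 0
      simp [coeff_quoSeries, coeff_tailSeries])) 1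
    fun r C hr f hf => by
      have := isUltrametricDist_of_padic p F
      rw [one_mul]
      exact coeffBound_quoSeries (ha j) j hr hf
  const i g := ∀ w, (Dagger.division p a ha).const i (LDagger.coeff w g)
  eq_add i g := LDagger.ext_coeff fun w => by
    rw [map_add, map_smul]
    exact (Dagger.division p a ha).eq_add i _
  rem_smul_self i g := LDagger.ext_coeff fun w => by
    have := (Dagger.division p a ha).rem_smul_self i (LDagger.coeff w g)
    rwa [← map_smul] at this
  rem_smul i j g hij := LDagger.ext_coeff fun w => by
    have := (Dagger.division p a ha).rem_smul i j (LDagger.coeff w g) hij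
    rw [← map_smul] at this
    exact this
  const_rem_self i g w := (Dagger.division p a ha).const_rem_self i _
  const_rem i j g hg w := (Dagger.division p a ha).const_rem i j _ (hg w)
  smul_injective i g hg := LDagger.ext_coeff fun w => by
    rw [map_zero]
    refine (Dagger.division p a ha).smul_injective i _ ?_
    rw [← map_smul, hg, map_zero]

end DaggerDivision

/-! ### The derived tensor product of a complex of forms -/

section FormTensor

open TensorProduct

theorem formD_map {B C M P : Type*} [CommRing B] [CommRing C] [AddCommGroup M] [Module B M]
    [AddCommGroup P] [Module C P] {n : ℕ} (D : Fin n → Module.End B M) (D' : Fin n → Module.End C P)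
    (h : M →+ P) (hD : ∀ i m, h (D i m) = D' i (h m)) (k : ℤ) (ω : FormIndex n k → M)
    (S : FormIndex n (k + 1)) :
    h (formD D k ω S) = formD D' k (fun T => h (ω T)) S := by
  -- `h` is only additive and the two signs live in different rings; they are compared through the
  -- parity of the exponent.
  have hpow : ∀ (c : ℕ) (m : M), h ((-1 : B) ^ c • m) = (-1 : C) ^ c • h m := by
    intro c m
    rcases neg_one_pow_eq_or B c with hB | hB <;> rcases Nat.even_or_odd c with hc | hc <;>
      simp [hc.neg_one_pow]
  simp only [formD, totalD, formPart, extendForm, LinearMap.comp_apply, LinearMap.pi_apply,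
    LinearMap.proj_apply, LinearMap.sum_apply, LinearMap.smul_apply, map_sum, hpow, hD]
  refine Finset.sum_congr rfl fun i _ => ?_
  split_ifs <;> simp

theorem formComplex_d (B : Type u) [CommRing B] (M : Type u) [AddCommGroup M] [Module B M] {n : ℕ}
    (D : Fin n → Module.End B M) (hD : ∀ i j m, D i (D j m) = D j (D i m)) (k : ℤ) :
    (formComplex B M D hD).d k (k + 1) = ModuleCat.ofHom (formD D k) :=
  CochainComplex.of_d (fun k => ModuleCat.of B (FormIndex n k → M))
    (fun k => ModuleCat.ofHom (formD D k)) k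

variable {B C : Type u} [CommRing B] [CommRing C] [Algebra B C] {M P : Type u}
  [AddCommGroup M] [Module B M] [AddCommGroup P] [Module B P] [Module C P] [IsScalarTower B C P]

/-- The `B`-linear identification of the restriction of scalars of a `C`-module with the module
itself. -/
def restrictScalarsEquiv (B : Type u) [CommRing B] [Algebra B C] (P : Type u) [AddCommGroup P]
    [Module B P] [Module C P] [IsScalarTower B C P] :
    ((ModuleCat.restrictScalars (algebraMap B C)).obj (ModuleCat.of C P)) ≃ₗ[B] P where
  toFun := fun x => x
  invFun := fun x => x
  map_add' _ _ := rfl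
  map_smul' b x := algebraMap_smul (M := P) C b x
  left_inv _ := rfl
  right_inv _ := rfl

/-- If `P = C ⊗ M` then `Mᵏ ⊗ C = Pᵏ`. -/
noncomputable def tensorPiEquiv {h : M →ₗ[B] P} (hh : IsBaseChange C h) (κ : Type) [Finite κ] :
    (κ → M) ⊗[B] ((ModuleCat.restrictScalars (algebraMap B C)).obj (ModuleCat.of C C)) ≃ₗ[B]
      ((ModuleCat.restrictScalars (algebraMap B C)).obj (ModuleCat.of C (κ → P))) :=
  LinearEquiv.lTensor _ (restrictScalarsEquiv B C) ≪≫ₗ TensorProduct.comm B (κ → M) C ≪≫ₗ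
    (hh.finitePow κ).equiv.restrictScalars B ≪≫ₗ (restrictScalarsEquiv B (κ → P)).symm

theorem tensorPiEquiv_tmul {h : M →ₗ[B] P} (hh : IsBaseChange C h) (κ : Type) [Finite κ]
    (m : κ → M) (x : C) :
    tensorPiEquiv hh κ (m ⊗ₜ x) = (x • (fun k => h (m k)) : κ → P) :=
  (hh.finitePow κ).equiv_tmul x m

/-- The differential over `C` is `C`-linear, so the factor `x` comes out and the intertwining of `D`
with `D'` remains. -/
theorem formD_tensorPiEquiv {n : ℕ} {D : Fin n → Module.End B M} {D' : Fin n → Module.End C P}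
    {h : M →ₗ[B] P} (hh : IsBaseChange C h) (hDD : ∀ i m, h (D i m) = D' i (h m)) (k : ℤ)
    (m : FormIndex n k → M) (x : C) :
    formD D' k (tensorPiEquiv hh (FormIndex n k) (m ⊗ₜ x)) =
      tensorPiEquiv hh (FormIndex n (k + 1)) (formD D k m ⊗ₜ x) := by
  rw [tensorPiEquiv_tmul, tensorPiEquiv_tmul]
  refine (map_smul (formD D' k) x _).trans (congrArg (x • ·) (funext fun S => ?_))
  exact (formD_map D D' h.toAddMonoidHom hDD k m S).symm

/-- The tensor product of a complex of forms with a base change of its coefficients. -/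
noncomputable def tensorFormComplexIso {n : ℕ} {D : Fin n → Module.End B M}
    (hD : ∀ i j m, D i (D j m) = D j (D i m)) {D' : Fin n → Module.End C P}
    (hD' : ∀ i j m, D' i (D' j m) = D' j (D' i m)) {h : M →ₗ[B] P} (hh : IsBaseChange C h)
    (hDD : ∀ i m, h (D i m) = D' i (h m)) :
    tensorComplex (formComplex B M D hD)
        ((ModuleCat.restrictScalars (algebraMap B C)).obj (ModuleCat.of C C)) ≅
      restrictComplex (algebraMap B C) (formComplex C P D' hD') :=
  HomologicalComplex.Hom.isoOfComponents
    (fun k => LinearEquiv.toModuleIso (tensorPiEquiv hh (FormIndex n k)))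
    (by
      rintro k _ rfl
      change (tensorPiEquiv hh (FormIndex n k)).toModuleIso.hom ≫
          (ModuleCat.restrictScalars (algebraMap B C)).map
            ((formComplex C P D' hD').d k (k + 1)) =
        (MonoidalCategory.tensorRight _).map ((formComplex B M D hD).d k (k + 1)) ≫
          (tensorPiEquiv hh (FormIndex n (k + 1))).toModuleIso.hom
      rw [formComplex_d, formComplex_d]
      exact ModuleCat.hom_ext (TensorProduct.ext' fun m x => formD_tensorPiEquiv hh hDD k m x))

/-- The abstract form of the theorem: `B'` is flat over `B`, `M'` is the base change of `M`, and
`C`, `P` are the quotients of `B'`, `M'` by the `c i`. The resolution may then be replaced by the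
complex itself when tensoring with `C`, and the resulting complex is computed by base change of the
coefficients. -/
theorem nonempty_derivedTensor_formComplex_iso {B' : Type u} [CommRing B'] [Algebra B B']
    [Algebra B' C] [IsScalarTower B B' C] [Module.Flat B B']
    {M' : Type u} [AddCommGroup M'] [Module B M'] [Module B' M'] [IsScalarTower B B' M']
    [Module B' P] [IsScalarTower B B' P] [IsScalarTower B' C P]
    {φ : M →ₗ[B] M'} (hφ : IsBaseChange B' φ) (ψ : M' →ₗ[B'] P)
    (hψ : Function.Surjective ψ) (hC : Function.Surjective (algebraMap B' C))
    {ι : Type*} [Fintype ι] {c : ι → B'} (hc : ∀ i, algebraMap B' C (c i) = 0)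
    (δ : Division c B') (δ' : Division c M')
    (hδ : ∀ f, (∀ i, δ.const i f) → algebraMap B' C f = 0 → f = 0)
    (hδ' : ∀ g, (∀ i, δ'.const i g) → ψ g = 0 → g = 0)
    {n : ℕ} {D : Fin n → Module.End B M}
    (hD : ∀ i j m, D i (D j m) = D j (D i m)) {D' : Fin n → Module.End C P}
    (hD' : ∀ i j m, D' i (D' j m) = D' j (D' i m))
    (hDD : ∀ i m, ψ (φ (D i m)) = D' i (ψ (φ m)))
    [HasDerivedCategory.{w} (ModuleCat.{u} B)] :
    Nonempty (derivedTensor (formComplex B M D hD) (n : ℤ)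
        ((ModuleCat.restrictScalars (algebraMap B C)).obj (ModuleCat.of C C)) ≅
      DerivedCategory.Q.obj (restrictComplex (algebraMap B C) (formComplex C P D' hD'))) := by
  have hker : Ideal.span (Set.range c) = RingHom.ker (algebraMap B' C) := by
    refine le_antisymm (Ideal.span_le.2 ?_) fun f hf => ?_
    · rintro _ ⟨i, rfl⟩
      exact hc i
    · have := δ.mem_of_map_eq_zero (algebraMap B' C).toAddMonoidHom
        (fun i m => by simp [hc]) hδ (m := f) hf
      rwa [smul_eq_mul, Ideal.mul_top] at this
  -- The kernel of `ψ` is generated by the `c i`, so `P` is `M'` reduced modulo the kernel of `B' →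
  -- C`.
  have hψ' : IsBaseChange C ψ := by
    refine isBaseChange_of_surjective hC ψ hψ fun g hg => ?_
    rw [← hker]
    refine δ'.mem_of_map_eq_zero ψ.toAddMonoidHom (fun i m => ?_) hδ' hg
    change ψ (c i • m) = 0
    rw [map_smul, ← algebraMap_smul C, hc, zero_smul]
  have hψφ := hφ.comp hψ'
  obtain ⟨-, hproj, hq⟩ := projRes_spec (formComplex B M D hD) (n : ℤ)
  have hflat : ∀ k, Module.Flat B ((projRes (formComplex B M D hD) (n : ℤ)).X k) := fun k => by
    have : Module.Projective B ((projRes (formComplex B M D hD) (n : ℤ)).X k) :=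
      IsProjective.iff_projective _ |>.2 (hproj k)
    infer_instance
  have key := TensorQuasiIso.quotient_span (projResπ (formComplex B M D hD) (n : ℤ)) hφ
    (fun k => ⟨FormIndex n k, inferInstance, ⟨LinearEquiv.refl B (FormIndex n k → M)⟩⟩) δ δ'
    Finset.univ
  rw [Finset.coe_univ, Set.image_univ, hker] at key
  have e : (B' ⧸ RingHom.ker (algebraMap B' C)) ≃ₗ[B]
      ((ModuleCat.restrictScalars (algebraMap B C)).obj (ModuleCat.of C C)) :=
    (Ideal.quotientKerAlgEquivOfSurjective
      (f := IsScalarTower.toAlgHom B B' C) hC).toLinearEquiv ≪≫ₗ (restrictScalarsEquiv B C).symm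
  -- The source of `q` represents the derived tensor product by definition; `key` makes `q` a
  -- quasi-isomorphism.
  let q : tensorComplex (projRes (formComplex B M D hD) (n : ℤ)) _ ⟶
      tensorComplex (formComplex B M D hD) _ :=
    ((MonoidalCategory.tensorRight ((ModuleCat.restrictScalars (algebraMap B C)).obj
      (ModuleCat.of C C))).mapHomologicalComplex (ComplexShape.up ℤ)).map
      (projResπ (formComplex B M D hD) (n : ℤ))
  have : IsIso (DerivedCategory.Q.map q) :=
    (DerivedCategory.isIso_Q_map_iff_quasiIso _ q).2 (key.of_iso e.toModuleIso)
  have i := asIso (DerivedCategory.Q.map q)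
  exact ⟨i ≪≫
    DerivedCategory.Q.mapIso (tensorFormComplexIso hD hD' hψφ hDD)⟩

/-- The same for semilinear maps along ring homomorphisms `σ : B → B'` and `τ : B' → C`, where
`e` is a basis of `B'` over `B` and, through `φ`, also of `M'` over `M`. -/
theorem nonempty_derivedTensor_formComplex_iso_of_semilinear {B B' C : Type u} [CommRing B]
    [CommRing B'] [CommRing C] (σ : B →+* B') {τ : B' →+* C} (hτ : Function.Surjective τ)
    {M M' P : Type u} [AddCommGroup M] [Module B M] [AddCommGroup M'] [Module B' M']
    [AddCommGroup P] [Module C P] (φ : M →ₛₗ[σ] M') (ψ : M' →ₛₗ[τ] P)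
    (hψ : Function.Surjective ψ) {κ : Type*} [Fintype κ] (e : κ → B')
    (hσ : Function.Bijective fun b : κ → B => ∑ i, e i * σ (b i))
    (hφ : Function.Bijective fun m : κ → M => ∑ i, e i • φ (m i))
    {ι : Type*} [Fintype ι] {c : ι → B'} (hc : ∀ i, τ (c i) = 0)
    (δ : Division c B') (δ' : Division c M')
    (hδ : ∀ f, (∀ i, δ.const i f) → τ f = 0 → f = 0)
    (hδ' : ∀ g, (∀ i, δ'.const i g) → ψ g = 0 → g = 0)
    {n : ℕ} {D : Fin n → Module.End B M}
    (hD : ∀ i j m, D i (D j m) = D j (D i m)) {D' : Fin n → Module.End C P}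
    (hD' : ∀ i j m, D' i (D' j m) = D' j (D' i m))
    (hDD : ∀ i m, ψ (φ (D i m)) = D' i (ψ (φ m)))
    [HasDerivedCategory.{w} (ModuleCat.{u} B)] :
    Nonempty (derivedTensor (formComplex B M D hD) (n : ℤ)
        ((ModuleCat.restrictScalars (τ.comp σ)).obj (ModuleCat.of C C)) ≅
      DerivedCategory.Q.obj (restrictComplex (τ.comp σ) (formComplex C P D' hD'))) := by
  classical
  -- All module structures are pulled back along the given homomorphisms, so the scalar towers hold
  -- by definition and semilinear maps become linear.
  let _ : Algebra B B' := σ.toAlgebra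
  let _ : Algebra B' C := τ.toAlgebra
  let _ : Algebra B C := (τ.comp σ).toAlgebra
  let _ : Module B M' := Module.compHom M' σ
  let _ : Module B' P := Module.compHom P τ
  let _ : Module B P := Module.compHom P (τ.comp σ)
  have : IsScalarTower B B' C := IsScalarTower.of_algebraMap_eq fun _ => rfl
  have : IsScalarTower B B' M' := IsScalarTower.of_algebraMap_smul fun _ _ => rfl
  have : IsScalarTower B C P := IsScalarTower.of_algebraMap_smul fun _ _ => rfl
  have : IsScalarTower B B' P := IsScalarTower.of_algebraMap_smul fun _ _ => rfl
  have : IsScalarTower B' C P := IsScalarTower.of_algebraMap_smul fun _ _ => rfl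
  -- `hσ` says exactly that `e` is a basis of `B'` over `B`; hence `B'` is free, in particular flat.
  have hL : Function.Bijective (Fintype.linearCombination B e) := by
    convert hσ using 1
    funext b
    rw [Fintype.linearCombination_apply]
    exact Finset.sum_congr rfl fun i _ => (Algebra.smul_def _ _).trans (mul_comm _ _)
  let β : Module.Basis κ B B' := Module.Basis.ofEquivFun (LinearEquiv.ofBijective _ hL).symm
  have hβ : ∀ i, β i = e i := fun i => by
    rw [Module.Basis.coe_ofEquivFun]
    change Fintype.linearCombination B e (Pi.single i 1) = _
    rw [Fintype.linearCombination_apply_single, one_smul]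
  have := Module.Free.of_basis β
  let φ' : M →ₗ[B] M' := { φ with map_smul' := φ.map_smulₛₗ }
  let ψ' : M' →ₗ[B'] P := { ψ with map_smul' := ψ.map_smulₛₗ }
  have hφ' : IsBaseChange B' φ' := by
    refine isBaseChange_of_basis β φ' ?_
    simp only [hβ]
    exact hφ
  exact nonempty_derivedTensor_formComplex_iso hφ' ψ' hψ hτ hc δ δ' hδ hδ' hD hD' hDD

end FormTensor

/-! ### Extension of the field of coefficients -/

section Extension

variable (p : ℕ) [Fact p.Prime] (K : Type u) [NormedField K] [NormedAlgebra ℚ_[p] K]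
  (K' : Type u) [NormedField K'] [NormedAlgebra ℚ_[p] K'] [NormedAlgebra K K']
  {n N : ℕ} (A : Matrix (Fin n) (Fin N) ℤ)

theorem coeffBound_map {r C : ℝ} {f : MvPowerSeries (Fin N) K} (hf : CoeffBound r C f) :
    CoeffBound r C (MvPowerSeries.map (algebraMap K K') f) := by
  intro v
  rw [MvPowerSeries.coeff_map, norm_algebraMap']
  exact hf v

/-- The inclusion of `K⟨x⟩†` in `K'⟨x⟩†`. -/
noncomputable def Dagger.map (N : ℕ) : Dagger p K N →+* Dagger p K' N :=
  RingHom.codRestrict ((MvPowerSeries.map (algebraMap K K')).comp (Dagger p K N).subtype)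
    (Dagger p K' N) (by
      rintro ⟨f, r, hr, C, h⟩
      exact ⟨r, hr, C, coeffBound_map K K' h⟩)

theorem Dagger.coeff_map (f : Dagger p K N) (v : Fin N →₀ ℕ) :
    MvPowerSeries.coeff v (Dagger.map p K K' N f).1 =
      algebraMap K K' (MvPowerSeries.coeff v f.1) := rfl

/-- The inclusion of the modules `L†` over `K` and `K'`. -/
noncomputable def LDagger.map : LDagger p K A →ₛₗ[Dagger.map p K K' N] LDagger p K' A where
  toFun := LDagger.mapCoeff (Dagger.map p K K' N) (map_zero _) 1 fun r C _ f hf => by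
    rw [one_mul]
    exact coeffBound_map K K' hf
  map_add' f g := LDagger.ext_coeff fun w =>
    (congrArg (Dagger.map p K K' N) (map_add (LDagger.coeff w) f g)).trans (map_add _ _ _)
  map_smul' b g := LDagger.ext_coeff fun w =>
    (congrArg (Dagger.map p K K' N) (map_smul (LDagger.coeff w) b g)).trans (map_mul _ _ _)

theorem LDagger.coeff_map (g : LDagger p K A) (w : Fin n → ℤ) :
    LDagger.coeff w (LDagger.map p K K' A g) = Dagger.map p K K' N (LDagger.coeff w g) := rfl

variable {p K K'}

/-- A linear form on a finite-dimensional space over the complete field `ℚ_[p]` is continuous, hence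
bounded. -/
theorem exists_norm_le_of_finiteDimensional [IsScalarTower ℚ_[p] K K'] [FiniteDimensional ℚ_[p] K']
    (φ : K' →ₗ[K] K) : ∃ c : ℝ, ∀ y, ‖φ y‖ ≤ c * ‖y‖ :=
  ⟨_, (LinearMap.toContinuousLinearMap (φ.restrictScalars ℚ_[p])).le_opNorm⟩

theorem coeffBound_linearMap {φ : K' →ₗ[K] K} {c : ℝ} (hc : ∀ y, ‖φ y‖ ≤ c * ‖y‖) {r C : ℝ}
    (hr : 1 < r) {f : MvPowerSeries (Fin N) K'} (hf : CoeffBound r C f) :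
    CoeffBound r (c * C) (fun v => φ (MvPowerSeries.coeff v f) : MvPowerSeries (Fin N) K) := by
  have hc0 : 0 ≤ c := by simpa using (norm_nonneg _).trans (hc 1)
  intro v
  have hr0 : 0 < r := one_pos.trans hr
  refine (mul_le_mul_of_nonneg_right (hc _) (by positivity)).trans ?_
  rw [mul_assoc]
  exact mul_le_mul_of_nonneg_left (hf v) hc0

/-- A bounded linear form applied to the coefficients of a series. -/
noncomputable def Dagger.mapLinear (φ : K' →ₗ[K] K) {c : ℝ} (hc : ∀ y, ‖φ y‖ ≤ c * ‖y‖)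
    (f : Dagger p K' N) : Dagger p K N :=
  ⟨fun v => φ (MvPowerSeries.coeff v f.1), by
    obtain ⟨f, r, hr, C, h⟩ := f
    exact ⟨r, hr, _, coeffBound_linearMap hc hr h⟩⟩

variable {ι : Type*} [Fintype ι] (b : Module.Basis ι K K')

/-- Reduces the next statements to expanding each coefficient in the basis `b`. -/
theorem Dagger.coeff_sum_smul (β : ι → Dagger p K N) (v : Fin N →₀ ℕ) :
    MvPowerSeries.coeff v (∑ i, algebraMap K' (Dagger p K' N) (b i) * Dagger.map p K K' N (β i)).1 =
      ∑ i, MvPowerSeries.coeff v (β i).1 • b i := by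
  rw [AddSubmonoidClass.coe_finsetSum, map_sum]
  refine Finset.sum_congr rfl fun i _ => ?_
  change MvPowerSeries.coeff v (MvPowerSeries.C (b i) * (Dagger.map p K K' N (β i)).1) = _
  rw [MvPowerSeries.coeff_C_mul, Dagger.coeff_map, mul_comm, Algebra.smul_def]

theorem Dagger.injective_sum_smul : Function.Injective fun β : ι → Dagger p K N =>
    ∑ i, algebraMap K' (Dagger p K' N) (b i) * Dagger.map p K K' N (β i) := by
  intro β β' h
  funext i
  refine Subtype.ext (MvPowerSeries.ext fun v => ?_)
  have h' : ∑ i, MvPowerSeries.coeff v (β i).1 • b i = ∑ i, MvPowerSeries.coeff v (β' i).1 • b i := by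
    rw [← Dagger.coeff_sum_smul, ← Dagger.coeff_sum_smul]
    exact congrArg (fun f : Dagger p K' N => MvPowerSeries.coeff v f.1) h
  rw [← b.equivFun_symm_apply fun i => MvPowerSeries.coeff v (β i).1,
    ← b.equivFun_symm_apply fun i => MvPowerSeries.coeff v (β' i).1] at h'
  exact congrFun (b.equivFun.symm.injective h') i

theorem Dagger.sum_smul_coord {c : ι → ℝ} (hc : ∀ i y, ‖b.coord i y‖ ≤ c i * ‖y‖)
    (f : Dagger p K' N) : ∑ i, algebraMap K' (Dagger p K' N) (b i) *
      Dagger.map p K K' N (Dagger.mapLinear (b.coord i) (hc i) f) = f := by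
  refine Subtype.ext (MvPowerSeries.ext fun v => ?_)
  rw [Dagger.coeff_sum_smul]
  exact b.sum_repr (MvPowerSeries.coeff v f.1)

variable [IsScalarTower ℚ_[p] K K'] [FiniteDimensional ℚ_[p] K']

/-- Coefficientwise this is the expansion in the basis `b`. The analytic content is in surjectivity:
bounded coordinate forms keep the same `r` and only enlarge the constant. -/
theorem Dagger.bijective_sum_smul : Function.Bijective fun β : ι → Dagger p K N =>
    ∑ i, algebraMap K' (Dagger p K' N) (b i) * Dagger.map p K K' N (β i) := by
  choose c hc using fun i => exists_norm_le_of_finiteDimensional (p := p) (b.coord i)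
  exact ⟨Dagger.injective_sum_smul b, fun f =>
    ⟨fun i => Dagger.mapLinear (b.coord i) (hc i) f, Dagger.sum_smul_coord b hc f⟩⟩

/-- The previous statement for each coefficient in `t`; the constants `c i` do not depend on `w`, so
the decay in `t` survives. -/
theorem LDagger.bijective_sum_smul : Function.Bijective fun m : ι → LDagger p K A =>
    ∑ i, algebraMap K' (Dagger p K' N) (b i) • LDagger.map p K K' A (m i) := by
  choose c hc using fun i => exists_norm_le_of_finiteDimensional (p := p) (b.coord i)
  have hcoeff : ∀ (m : ι → LDagger p K A) (w : Fin n → ℤ),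
      LDagger.coeff w (∑ i, algebraMap K' (Dagger p K' N) (b i) • LDagger.map p K K' A (m i)) =
        ∑ i, algebraMap K' (Dagger p K' N) (b i) *
          Dagger.map p K K' N (LDagger.coeff w (m i)) := by
    intro m w
    rw [map_sum]
    refine Finset.sum_congr rfl fun i _ => ?_
    rw [map_smul, LDagger.coeff_map, smul_eq_mul]
  refine ⟨fun m m' h => ?_, fun g => ?_⟩
  · refine funext fun i => LDagger.ext_coeff fun w => ?_
    have h' := congrArg (LDagger.coeff w) h
    dsimp only at h'
    rw [hcoeff, hcoeff] at h'
    exact congrFun (Dagger.injective_sum_smul b h') i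
  · have h0 : ∀ i, Dagger.mapLinear (p := p) (N := N) (b.coord i) (hc i) 0 = 0 := fun i =>
      Subtype.ext (MvPowerSeries.ext fun v => map_zero (b.coord i))
    refine ⟨fun i => LDagger.mapCoeff (Dagger.mapLinear (b.coord i) (hc i)) (h0 i) (c i)
      (fun r C hr f hf => coeffBound_linearMap (hc i) hr hf) g, LDagger.ext_coeff fun w => ?_⟩
    dsimp only
    rw [hcoeff]
    exact Dagger.sum_smul_coord b hc _

end Extension

/-! ### Evaluation at a point of the closed unit polydisc -/

section Evaluation

variable {p : ℕ} [Fact p.Prime] {F : Type u} [NormedField F] [NormedAlgebra ℚ_[p] F]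
  {n N : ℕ} (A : Matrix (Fin n) (Fin N) ℤ) (a : Fin N → F) (ha : ∀ j, ‖a j‖ ≤ 1)

theorem Dagger.eval_eq_tsum {K : Type u} [NormedField K] [NormedAlgebra ℚ_[p] K]
    [FiniteDimensional ℚ_[p] K] [NormedAlgebra K F] [IsScalarTower ℚ_[p] K F]
    [FiniteDimensional K F] (f : Dagger p K N) :
    Dagger.eval p K F a ha f = ∑' v : Fin N →₀ ℕ,
      algebraMap K F (MvPowerSeries.coeff v f.1) * ∏ j, a j ^ v j := rfl

variable [FiniteDimensional ℚ_[p] F]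

/-- This factors evaluation through the ring over `F`, where the point has coordinates in the
coefficient field; the two sums have identical terms. -/
theorem Dagger.eval_map {K : Type u} [NormedField K] [NormedAlgebra ℚ_[p] K]
    [FiniteDimensional ℚ_[p] K] [NormedAlgebra K F] [IsScalarTower ℚ_[p] K F]
    [FiniteDimensional K F] (f : Dagger p K N) :
    Dagger.eval p F F a ha (Dagger.map p K F N f) = Dagger.eval p K F a ha f := rfl

theorem Dagger.eval_eq_coeff_zero {f : Dagger p F N}
    (hf : ∀ v, v ≠ 0 → MvPowerSeries.coeff v f.1 = 0) :
    Dagger.eval p F F a ha f = MvPowerSeries.coeff 0 f.1 := by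
  rw [Dagger.eval_eq_tsum, tsum_eq_single 0]
  · simp
  · intro v hv
    rw [hf v hv, map_zero, zero_mul]

theorem Dagger.eval_algebraMap (y : F) :
    Dagger.eval p F F a ha (algebraMap F (Dagger p F N) y) = y := by
  rw [Dagger.eval_eq_coeff_zero]
  · exact MvPowerSeries.coeff_zero_C y
  · intro v hv
    exact MvPowerSeries.coeff_C_of_ne_zero hv y

theorem Dagger.eval_X (j : Fin N) : Dagger.eval p F F a ha (Dagger.X p F j) = a j := by
  classical
  rw [Dagger.eval_eq_tsum, tsum_eq_single (Finsupp.single j 1)]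
  · change algebraMap F F (MvPowerSeries.coeff (Finsupp.single j 1) (MvPowerSeries.X j)) * _ = _
    rw [MvPowerSeries.coeff_index_single_self_X, map_one, one_mul, Finset.prod_eq_single j]
    · simp
    · intro i _ hij
      simp [hij.symm]
    · simp
  · intro v hv
    change algebraMap F F (MvPowerSeries.coeff v (MvPowerSeries.X j)) * _ = _
    rw [MvPowerSeries.coeff_X, if_neg hv, map_zero, zero_mul]

theorem Dagger.eval_XSub (j : Fin N) : Dagger.eval p F F a ha (Dagger.XSub p a j) = 0 := by
  rw [Dagger.XSub, map_sub, Dagger.eval_X, Dagger.eval_algebraMap, sub_self]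

/-- As `‖a j‖ ≤ 1` and `r > 1`, every term is bounded by `C`, hence so is the sum. With `C`
depending on `w` this puts values of series in L† into L_0†. -/
theorem Dagger.norm_eval_le {r C : ℝ} (hr : 1 < r) {f : Dagger p F N}
    (hf : CoeffBound r C f.1) : ‖Dagger.eval p F F a ha f‖ ≤ C := by
  have := isUltrametricDist_of_padic p F
  rw [Dagger.eval_eq_tsum]
  refine norm_tsum_le_of_forall_le hf.nonneg fun v => ?_
  have h1 : ∏ j, ‖a j ^ v j‖ ≤ 1 := Finset.prod_le_one (fun _ _ => norm_nonneg _) fun j _ => by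
    rw [norm_pow]
    exact pow_le_one₀ (norm_nonneg _) (ha j)
  rw [norm_mul, norm_prod]
  refine (mul_le_of_le_one_right (norm_nonneg _) h1).trans (le_trans ?_ (hf v))
  exact le_mul_of_one_le_right (norm_nonneg _) (one_le_pow₀ hr.le)

/-- No variable occurs in `f`, so `f` is its constant term, which is also its value. -/
theorem Dagger.eq_zero_of_eval_eq_zero [CompleteSpace F] {f : Dagger p F N}
    (hf : ∀ i, (Dagger.division p a ha).const i f) (h : Dagger.eval p F F a ha f = 0) : f = 0 := by
  have hf' : ∀ v, v ≠ 0 → MvPowerSeries.coeff v f.1 = 0 := by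
    intro v hv
    obtain ⟨i, hi⟩ := Finsupp.ne_iff.1 hv
    exact hf i v hi
  rw [Dagger.eval_eq_coeff_zero a ha hf'] at h
  refine Subtype.ext (MvPowerSeries.ext fun v => ?_)
  by_cases hv : v = 0
  · rw [hv, h]
    rfl
  · rw [hf' v hv]
    rfl

/-- The value at `a` of a series in `L†`. -/
noncomputable def LDagger.evalHom : LDagger p F A →ₛₗ[Dagger.eval p F F a ha] LZeroDagger F A where
  toFun g := ⟨fun w => Dagger.eval p F F a ha (LDagger.coeff w g), by
    refine ⟨fun w hw => ?_, ?_⟩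
    · have : LDagger.coeff w g = 0 := Subtype.ext (g.2.1 w hw)
      dsimp only
      rw [this, map_zero]
    · obtain ⟨r, hr, s, hs, C, h⟩ := LDagger_exists_coeffBound g
      refine ⟨s, hs, C, fun w _ => ?_⟩
      rw [← le_div_iff₀ (Real.rpow_pos_of_pos (one_pos.trans hs) _)]
      exact Dagger.norm_eval_le a ha hr (h w)⟩
  map_add' f g := Subtype.ext (funext fun w => by
    change Dagger.eval p F F a ha (LDagger.coeff w (f + g)) =
      Dagger.eval p F F a ha (LDagger.coeff w f) + Dagger.eval p F F a ha (LDagger.coeff w g)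
    rw [map_add, map_add])
  map_smul' f g := Subtype.ext (funext fun w => by
    change Dagger.eval p F F a ha (LDagger.coeff w (f • g)) =
      Dagger.eval p F F a ha f * Dagger.eval p F F a ha (LDagger.coeff w g)
    rw [map_smul, smul_eq_mul, map_mul])

theorem LDagger.evalHom_apply (g : LDagger p F A) (w : Fin n → ℤ) :
    (LDagger.evalHom A a ha g).1 w = Dagger.eval p F F a ha (LDagger.coeff w g) := rfl

theorem LDagger.evalHom_surjective : Function.Surjective (LDagger.evalHom (p := p) A a ha) := by
  classical
  rintro ⟨h, h0, s, hs, C, hb⟩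
  have hs0 : 0 < s := one_pos.trans hs
  have hC : 0 ≤ C := le_trans (by positivity) (hb 0 (by rw [toReal_zero]; exact zero_mem _))
  -- Lift to series constant in `x`; any radius above 1 works, here 2, since only the exponent `v =
  -- 0` contributes.
  refine ⟨⟨fun w => MvPowerSeries.C (h w), fun w hw => by simp [h0 w hw], 2, one_lt_two,
    s, hs, C, fun v w hw => ?_⟩, Subtype.ext (funext fun w => ?_)⟩
  · rw [MvPowerSeries.coeff_C]
    split_ifs with hv
    · simpa [hv] using hb w hw
    · simpa using hC
  · exact Dagger.eval_algebraMap a ha (h w)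

theorem LDagger.eq_zero_of_evalHom_eq_zero [CompleteSpace F] {g : LDagger p F A}
    (hg : ∀ i, (LDagger.division A a ha).const i g) (h : LDagger.evalHom A a ha g = 0) : g = 0 :=
  LDagger.ext_coeff fun w => by
    rw [map_zero]
    exact Dagger.eq_zero_of_eval_eq_zero a ha (fun i => hg i w) (congrFun (congrArg Subtype.val h) w)

theorem LDagger.coeff_D {K : Type u} [NormedField K] [NormedAlgebra ℚ_[p] K] (γ : Fin n → K)
    (π : K) (i : Fin n) (g : LDagger p K A) (w : Fin n → ℤ) :
    LDagger.coeff w (LDagger.D p K A γ π i g) =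
      w i • LDagger.coeff w g + algebraMap K (Dagger p K N) (γ i) * LDagger.coeff w g +
        ∑ j, A i j • (algebraMap K (Dagger p K N) π * Dagger.X p K j *
          LDagger.coeff (w - A.col j) g) := by
  refine Subtype.ext ?_
  simp only [AddMemClass.coe_add, AddSubmonoidClass.coe_finsetSum]
  rfl

/-- Evaluation is a ring homomorphism acting on each coefficient in `t`, so it commutes with the
shifts and with `t_i ∂/∂t_i`, and it sends `x_j` to `a_j`. -/
theorem LDagger.evalHom_map_D {K : Type u} [NormedField K] [NormedAlgebra ℚ_[p] K]
    [FiniteDimensional ℚ_[p] K] [NormedAlgebra K F] [IsScalarTower ℚ_[p] K F]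
    [FiniteDimensional K F] (γ : Fin n → K) (π : K) (i : Fin n) (g : LDagger p K A) :
    LDagger.evalHom A a ha (LDagger.map p K F A (LDagger.D p K A γ π i g)) =
      LZeroDagger.D p F A (fun i => algebraMap K F (γ i)) (algebraMap K F π) a i
        (LDagger.evalHom A a ha (LDagger.map p K F A g)) := by
  have hC : ∀ y : K, Dagger.map p K F N (algebraMap K (Dagger p K N) y) =
      algebraMap F (Dagger p F N) (algebraMap K F y) := fun y =>
    Subtype.ext (MvPowerSeries.map_C _ y)
  have hX : ∀ j, Dagger.map p K F N (Dagger.X p K j) = Dagger.X p F j := fun j =>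
    Subtype.ext (MvPowerSeries.map_X _ j)
  refine Subtype.ext (funext fun w => ?_)
  rw [LDagger.evalHom_apply, LDagger.coeff_map, LDagger.coeff_D]
  simp only [map_add, map_sum, map_zsmul, map_mul, hC, hX, Dagger.eval_algebraMap, Dagger.eval_X]
  rfl

end Evaluation

end PGKZ

/-! ### The base change isomorphism -/

theorem corollary1 (p : ℕ) [Fact p.Prime]
    (K : Type u) [NormedField K] [NormedAlgebra ℚ_[p] K] [FiniteDimensional ℚ_[p] K]
    (π : K) (hπ : π ^ (p - 1) + (p : K) = 0)
    {n N : ℕ} (A : Matrix (Fin n) (Fin N) ℤ)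
    (hA : (A.map (fun z : ℤ => (z : ℚ))).rank = n)
    (γ : Fin n → K)
    (K' : Type u) [NormedField K'] [NormedAlgebra ℚ_[p] K'] [NormedAlgebra K K']
    [IsScalarTower ℚ_[p] K K'] [FiniteDimensional K K']
    (a : Fin N → K') (ha : ∀ j, ‖a j‖ ≤ 1)
    [HasDerivedCategory.{w} (ModuleCat.{u} (PGKZ.Dagger p K N))] :
    Nonempty
      (PGKZ.derivedTensor (PGKZ.gkzComplex p K A γ π) (n : ℤ)
          ((ModuleCat.restrictScalars (PGKZ.Dagger.eval p K K' a ha)).obj (ModuleCat.of K' K')) ≅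
        DerivedCategory.Q.obj
          (PGKZ.restrictComplex (PGKZ.Dagger.eval p K K' a ha)
            (PGKZ.gkzComplexAt p K' A (fun i => algebraMap K K' (γ i)) (algebraMap K K' π) a))) := by
  have : FiniteDimensional ℚ_[p] K' := FiniteDimensional.trans ℚ_[p] K K'
  have : CompleteSpace K' := FiniteDimensional.complete ℚ_[p] K'
  -- Passing to coefficients in `K'` first makes the point rational, so that the elements X_j - a_j
  -- exist in the ring.
  have h : PGKZ.Dagger.eval p K K' a ha =
      (PGKZ.Dagger.eval p K' K' a ha).comp (PGKZ.Dagger.map p K K' N) :=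
    RingHom.ext fun f => (PGKZ.Dagger.eval_map a ha f).symm
  rw [h]
  let b := Module.finBasis K K'
  have hσ := PGKZ.Dagger.bijective_sum_smul (p := p) (N := N) b
  have hφ := PGKZ.LDagger.bijective_sum_smul (p := p) A b
  have hψ := PGKZ.LDagger.evalHom_surjective (p := p) A a ha
  have hτ : Function.Surjective (PGKZ.Dagger.eval p K' K' a ha) := fun y =>
    ⟨algebraMap K' _ y, PGKZ.Dagger.eval_algebraMap a ha y⟩
  have hδ := fun f => PGKZ.Dagger.eq_zero_of_eval_eq_zero (p := p) a ha (f := f)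
  have hδ' := fun g => PGKZ.LDagger.eq_zero_of_evalHom_eq_zero (p := p) A a ha (g := g)
  have hD := PGKZ.LDagger.D_comm p K A γ π
  have hD' := PGKZ.LZeroDagger.D_comm p K' A (fun i => algebraMap K K' (γ i)) (algebraMap K K' π) a
  have hDD := PGKZ.LDagger.evalHom_map_D (p := p) A a ha γ π
  have hc := PGKZ.Dagger.eval_XSub (p := p) a ha
  have key := PGKZ.nonempty_derivedTensor_formComplex_iso_of_semilinear
    (B := PGKZ.Dagger p K N) (B' := PGKZ.Dagger p K' N) (C := K') (M := PGKZ.LDagger p K A)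
    (M' := PGKZ.LDagger p K' A) (P := PGKZ.LZeroDagger K' A) (PGKZ.Dagger.map p K K' N) hτ
    (PGKZ.LDagger.map p K K' A) (PGKZ.LDagger.evalHom A a ha) hψ
    fun i => algebraMap K' (PGKZ.Dagger p K' N) (b i)
  have key' := fun h₁ h₂ => key h₁ h₂ hc (PGKZ.Dagger.division p a ha)
    (PGKZ.LDagger.division A a ha) hδ hδ' (D := PGKZ.LDagger.D p K A γ π) hD
    (D' := PGKZ.LZeroDagger.D p K' A (fun i => algebraMap K K' (γ i)) (algebraMap K K' π) a) hD'
    hDD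
  exact key' hσ hφ
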